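/- Let $n\ge 0$, $s\ge 1$ be integers and let $(M,f,\xi_1,\dots,\xi_s,\eta^1,\dots,\eta^s,g)$ be an $S$-manifold of dimension $2n+s$. That is: $M$ is a smooth manifold with a Riemannian metric $g$, a $(1,1)$-tensor field $f$, vector fields $\xi_\alpha$ and 1-forms $\eta^\alpha$ with $$f^2=-I+\sum_{\alpha}\eta^\alpha\otimes\xi_\alpha,\quad \eta^\alpha(\xi_\beta)=\delta_{\alpha\beta},\quad f\xi_\alpha=0,\quad \eta^\alpha\circ f=0,\quad g(fX,fY)=g(X,Y)-\sum_\alpha\eta^\alpha(X)\eta^\alpha(Y),$$ which is normal, $[f,f]+2\sum_\alpha d\eta^\alpha\otimes\xi_\alpha=0$ (where $[f,f](X,Y)=f^2[X,Y]+[fX,fY]-f[fX,Y]-f[X,fY]$), and satisfies $d\eta^\alpha(X,Y)=g(X,fY)$ for all $\alpha$, with the convention $d\eta(X,Y)=\tfrac12\{X\eta(Y)-Y\eta(X)-\eta([X,Y])\}$. Let $\mathcal L$ be the orthogonal complement of the distribution spanned by $\xi_1,\dots,\xi_s$, let $\nabla$ be the Levi-Civita connection of $g$, and let $$\tilde\nabla_XY=\nabla_XY+\sum_{j=1}^s\eta^j(Y)X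 .$$ For a linear connection $D$ with curvature $R(X,Y)Z=D_XD_YZ-D_YD_XZ-D_{[X,Y]}Z$ put $$K(X,Y)=\frac{g(R(X,Y)Y,X)}{g(X,X)g(Y,Y)-g(X,Y)^2}$$ for linearly independent $X,Y$, and $K(X,Y)=0$ otherwise. The scalar curvature of $D$ is $\tau=\frac12\sum_{i,j=1}^{2n+s}K(e_i,e_j)$, for any local orthonormal frame $e_1,\dots,e_{2n+s}$. Say that $D$ has constant $\mathcal L$-sectional curvature $c$ if, at every point, $K(X,Y)=c$ for all orthonormal $X,Y\in\mathcal L$, and constant $f$-sectional curvature $c$ if, at every point, $K(X,fX)=c$ for all unit $X\in\mathcal L$. Write $K,\tau$ for the quantities of $\nabla$ and $\tilde K,\tilde\tau$ for those of $\tilde\nabla$. Then: 1. $\tilde K(X,Y)=K(X,Y)$ for all orthogonal $X,Y\in\mathcal L$. 2. If $n\ge 2$, $M\neq\emptyset$ and $\tilde\nabla$ has constant $\mathcal L$-sectional curvature $c\in\mathbb R$, then $c=s$. 3. If $\tilde\nabla$ has constant $\mathcal L$-sectional curvature $s$, then $$\tilde\tau=2ns(n+1)+\frac{s(s-1)}2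 .$$ 4. For every $c\in\mathbb R$, $\tilde\nabla$ has constant $f$-sectional curvature $c$ if and only if $\nabla$ does; and in this case (that is, if $M$ is an $S$-space-form of constant $f$-sectional curvature $c$) $$\tilde\tau=\frac{n(n+1)(c+3s)+s(s-1)}2 .$$ -/

import Mathlib

open Bundle VectorField
open scoped Manifold ContDiff

noncomputable section

namespace SGeom

section Connections

variable {E : Type*} [NormedAddCommGroup E] [NormedSpace ℝ E] [FiniteDimensional ℝ E]
  {H : Type*} [TopologicalSpace H] {I : ModelWithCorners ℝ E H}
  {M : Type*} [TopologicalSpace M] [ChartedSpace H M]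

/-- A vector field on `M` (a section of the tangent bundle, not necessarily smooth). -/
abbrev VField (I : ModelWithCorners ℝ E H) (M : Type*) [TopologicalSpace M] [ChartedSpace H M] :=
  (x : M) → TangentSpace I x

variable [IsManifold I ∞ M]

/-- The vector field `X` is of class `C^∞` on the set `U`. -/
def SmoothOn (X : VField I M) (U : Set M) : Prop :=
  ContMDiffOn I (I.prod 𝓘(ℝ, E)) ∞ (fun x => (TotalSpace.mk' E x (X x) : TangentBundle I M)) U

/-- `X` is an element of `𝒳(M)`: a globally defined smooth vector field. -/
def Smooth (X : VField I M) : Prop := SmoothOn X Set.univ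

/-- The vector field `∇_X Y` (Mathlib writes `∇ Y x (X x)` for its value at `x`). -/
def nabla (D : CovariantDerivative I E (TangentSpace I : M → Type _)) (X Y : VField I M) :
    VField I M :=
  fun x => D Y x (X x)

/-- The curvature `R(X,Y)Z = ∇_X ∇_Y Z - ∇_Y ∇_X Z - ∇_{[X,Y]} Z`. -/
def curvature (D : CovariantDerivative I E (TangentSpace I : M → Type _)) (X Y Z : VField I M) :
    VField I M :=
  nabla D X (nabla D Y Z) - nabla D Y (nabla D X Z) - nabla D (mlieBracket I X Y) Z

/-- The exterior derivative of a 1-form, evaluated on two vector fields, with the convention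
`dη(X,Y) = (X(η(Y)) - Y(η(X)) - η([X,Y])) / 2`. -/
def extDer (η : (x : M) → TangentSpace I x →L[ℝ] ℝ) (X Y : VField I M) (x : M) : ℝ :=
  (mvfderiv I (fun y => η y (Y y)) x (X x) - mvfderiv I (fun y => η y (X y)) x (Y x)
    - η x (mlieBracket I X Y x)) / 2

/-- The Nijenhuis torsion `[f,f](X,Y) = f²[X,Y] + [fX,fY] - f[fX,Y] - f[X,fY]` of a field of
endomorphisms `f` of the tangent bundle. -/
def nijenhuis (f : (x : M) → TangentSpace I x →L[ℝ] TangentSpace I x) (X Y : VField I M) :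
    VField I M :=
  fun x => f x (f x (mlieBracket I X Y x))
    + mlieBracket I (fun y => f y (X y)) (fun y => f y (Y y)) x
    - f x (mlieBracket I (fun y => f y (X y)) Y x)
    - f x (mlieBracket I X (fun y => f y (Y y)) x)

variable [RiemannianBundle (fun x : M => TangentSpace I x)]

/-- The curvature tensor with four arguments `R(X,Y,Z,W) = g(R(X,Y)Z, W)`. -/
def curvature₄ (D : CovariantDerivative I E (TangentSpace I : M → Type _))
    (X Y Z W : VField I M) (x : M) : ℝ :=
  inner ℝ (curvature D X Y Z x) (W x)

/-- `K(X,Y) = R(X,Y,Y,X) / (g(X,X) g(Y,Y) - g(X,Y)²)`, as a function of the ordered pair `(X,Y)`.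
For an orthonormal pair it is `R(X,Y,Y,X)`. For linearly dependent `X`, `Y`, in particular for
`X = Y`, the value is `0`. -/
def sectional (D : CovariantDerivative I E (TangentSpace I : M → Type _))
    (X Y : VField I M) (x : M) : ℝ :=
  curvature₄ D X Y Y X x /
    (inner ℝ (X x) (X x) * inner ℝ (Y x) (Y x) - inner ℝ (X x) (Y x) ^ 2)

/-- The scalar curvature of `D` is the function `τ`: around every point, and for every local
smooth orthonormal frame `e₁, …, e_m` of the tangent bundle (`m = dim M`),
`τ = (1/2) ∑_{i,j} K(e_i, e_j)`. -/
def HasScalarCurvature (D : CovariantDerivative I E (TangentSpace I : M → Type _))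
    (τ : M → ℝ) : Prop :=
  ∀ (U : Set M) (e : Fin (Module.finrank ℝ E) → VField I M), IsOpen U →
    (∀ i, SmoothOn (e i) U) → (∀ x ∈ U, Orthonormal ℝ (fun i => e i x)) →
      ∀ p ∈ U, τ p = (1 / 2) * ∑ i, ∑ j, sectional D (e i) (e j) p

/-- `D` is the Riemannian (Levi-Civita) connection of the metric `g`: the smooth linear connection
with vanishing torsion and with `X(g(Y,Z)) = g(∇_X Y, Z) + g(Y, ∇_X Z)`. -/
structure IsLeviCivita (D : CovariantDerivative I E (TangentSpace I : M → Type _)) : Prop where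
  smooth : CovariantDerivative.ContMDiffCovariantDerivative D ∞
  torsion_free : D.torsion = 0
  metric : ∀ X Y Z : VField I M, Smooth X → Smooth Y → Smooth Z → ∀ x,
    mvfderiv I (fun y => (inner ℝ (Y y) (Z y) : ℝ)) x (X x)
      = inner ℝ (nabla D X Y x) (Z x) + inner ℝ (Y x) (nabla D X Z x)

end Connections

section SManifolds

variable {E : Type*} [NormedAddCommGroup E] [NormedSpace ℝ E] [FiniteDimensional ℝ E]
  {H : Type*} [TopologicalSpace H]

/-- A metric `f`-structure with `s` structure vector fields on the Riemannian manifold `M`. -/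
structure MetricFStructure (I : ModelWithCorners ℝ E H) (M : Type*) [TopologicalSpace M]
    [ChartedSpace H M] [IsManifold I ∞ M] [RiemannianBundle (fun x : M => TangentSpace I x)]
    (s : ℕ) where
  /-- the tensor field `f` of type `(1,1)` -/
  f : (x : M) → TangentSpace I x →L[ℝ] TangentSpace I x
  /-- the structure vector fields -/
  ξ : Fin s → VField I M
  /-- the 1-forms `η^α` -/
  η : Fin s → (x : M) → TangentSpace I x →L[ℝ] ℝ
  smooth_f : ContMDiff I (I.prod 𝓘(ℝ, E →L[ℝ] E)) ∞
    (fun x => TotalSpace.mk' (E →L[ℝ] E)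
      (E := fun x : M => TangentSpace I x →L[ℝ] TangentSpace I x) x (f x))
  smooth_ξ : ∀ α, Smooth (ξ α)
  smooth_η : ∀ α, ContMDiff I (I.prod 𝓘(ℝ, E →L[ℝ] ℝ)) ∞
    (fun x => TotalSpace.mk' (E →L[ℝ] ℝ)
      (E := fun x : M => TangentSpace I x →L[ℝ] Trivial M ℝ x) x (η α x))
  f_sq : ∀ x (v : TangentSpace I x), f x (f x v) = -v + ∑ α, η α x v • ξ α x
  η_ξ : ∀ α β x, η α x (ξ β x) = if α = β then 1 else 0
  f_ξ : ∀ α x, f x (ξ α x) = 0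
  η_f : ∀ α x (v : TangentSpace I x), η α x (f x v) = 0
  compat : ∀ x (v w : TangentSpace I x),
    inner ℝ (f x v) (f x w) = inner ℝ v w - ∑ α, η α x v * η α x w

namespace MetricFStructure

variable {I : ModelWithCorners ℝ E H} {M : Type*} [TopologicalSpace M]
  [ChartedSpace H M] [IsManifold I ∞ M] [RiemannianBundle (fun x : M => TangentSpace I x)]
  {s : ℕ} (S : MetricFStructure I M s)

/-- The fundamental 2-form `Φ(X,Y) = g(X, fY)`. -/
def Φ (X Y : VField I M) (x : M) : ℝ := inner ℝ (X x) (S.f x (Y x))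

/-- The fibre at `x` of the distribution spanned by the structure vector fields. -/
def vert (x : M) : Submodule ℝ (TangentSpace I x) :=
  Submodule.span ℝ (Set.range fun α => S.ξ α x)

/-- The fibre at `x` of the distribution `ℒ`, the orthogonal complement of the structure
vector fields. -/
def L (x : M) : Submodule ℝ (TangentSpace I x) := (S.vert x)ᗮ

/-- Normality: `[f,f] + 2 ∑_α dη^α ⊗ ξ_α = 0`. -/
def IsNormal : Prop :=
  ∀ X Y : VField I M, Smooth X → Smooth Y → ∀ x,
    nijenhuis S.f X Y x + (2 : ℝ) • ∑ α, extDer (S.η α) X Y x • S.ξ α x = 0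

/-- An `S`-structure: a normal metric `f`-structure with `dη^α = Φ` for all `α`.
(In dimension `2n+s` this forces `η^1 ∧ ⋯ ∧ η^s ∧ (dη^α)^n ≠ 0`, as `Φ` is nondegenerate
on `ℒ`.) -/
structure IsSStructure : Prop where
  normal : S.IsNormal
  extDer_η : ∀ α, ∀ X Y : VField I M, Smooth X → Smooth Y → ∀ x,
    extDer (S.η α) X Y x = S.Φ X Y x

/-- The semi-symmetric non-metric connection `∇̃_X Y = ∇_X Y + ∑_j η^j(Y) X` associated with
the connection `D = ∇`: `addOneForm` adds the tensor `(Y, X) ↦ ∑_j η^j(Y) X` to `D`. -/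
def semiSymm (D : CovariantDerivative I E (TangentSpace I : M → Type _)) :
    CovariantDerivative I E (TangentSpace I : M → Type _) :=
  D.addOneForm fun x =>
    (∑ j, S.η j x).smulRight (ContinuousLinearMap.id ℝ (TangentSpace I x))

/-- The `ℒ`-sectional curvature of `D` is constant, equal to `c`: `K(X,Y) = c` whenever
`X`, `Y` are orthonormal and in `ℒ`. -/
def HasConstLSectional (D : CovariantDerivative I E (TangentSpace I : M → Type _))
    (c : ℝ) : Prop :=
  ∀ X Y : VField I M, Smooth X → Smooth Y → ∀ p, X p ∈ S.L p → Y p ∈ S.L p →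
    inner ℝ (X p) (X p) = (1 : ℝ) → inner ℝ (Y p) (Y p) = (1 : ℝ) →
    inner ℝ (X p) (Y p) = (0 : ℝ) → sectional D X Y p = c

/-- The `f`-sectional curvature of `D` is constant, equal to `c`: `K(X,fX) = c` whenever
`X` is a unit vector in `ℒ`. -/
def HasConstFSectional (D : CovariantDerivative I E (TangentSpace I : M → Type _))
    (c : ℝ) : Prop :=
  ∀ X : VField I M, Smooth X → ∀ p, X p ∈ S.L p → inner ℝ (X p) (X p) = (1 : ℝ) →
    sectional D X (fun x => S.f x (X x)) p = c

end MetricFStructure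

end SManifolds

end SGeom

end

set_option linter.unusedSectionVars false

open scoped Topology

noncomputable section

/-! Write π = ∑ η^α (`ηSum`). Two structure equations of an S-manifold carry the proof: ∇_v ξ_α = -f
v (`cov_ξ`) and the formula for ∇f (`covF_eq`). The first gives (∇_v π)(Z) = -s g(Z, f v), so
R̃(X,Y)Z - R(X,Y)Z consists of terms with a factor g(Z, fX), g(Z, fY) or π(Z)
(`curvature_semiSymm`). In R̃(X,Y,Y,X) with X ⟂ Y and Y ∈ ℒ they all drop out. This is claim 1, and
with Y = fX it is the equivalence in claim 4.

The other claims use `riem_f_f`: for w, z ∈ ℒ, R(u,v,fw,fz) equals R(u,v,w,z) plus s times an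
explicit expression in g and f. If the sectional curvature on ℒ is c, then R restricted to ℒ is the
tensor of constant curvature c. For orthonormal u, v ∈ ℒ with v ⟂ fu, which exist when n ≥ 2, that
tensor gives R(u,v,fv,fu) = 0, while `riem_f_f` gives c - s. If only the f-sectional curvature is c,
subtract a tensor of complex-space-form type with the same defect under f. The difference is of
Kähler type on ℒ with zero holomorphic sectional curvature, so its sectional curvature vanishes
(`sectional_eq_zero_of_holomorphic`).

For the scalar curvature, `riem_eq_horizontal` splits R(u,v,v,u) into a horizontal part and terms
determined by R(·,·)ξ_α. Parseval's identity then sums over the frame, and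
`hasScalarCurvature_semiSymm` covers both formulas at once. -/

namespace SGeom

/-! ### Smooth vector fields and their extension from germs and vectors. -/

section Smoothness

variable {E : Type*} [NormedAddCommGroup E] [NormedSpace ℝ E] [FiniteDimensional ℝ E]
  {H : Type*} [TopologicalSpace H] {I : ModelWithCorners ℝ E H}
  {M : Type*} [TopologicalSpace M] [ChartedSpace H M] [IsManifold I ∞ M]
  {X Y Z X' Y' Z' : VField I M} {p : M}

lemma smooth_iff : Smooth X ↔
    ContMDiff I (I.prod 𝓘(ℝ, E)) ∞ (fun x => (TotalSpace.mk' E x (X x) : TangentBundle I M)) :=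
  contMDiffOn_univ

lemma Smooth.contMDiff (hX : Smooth X) :
    ContMDiff I (I.prod 𝓘(ℝ, E)) ∞ (fun x => (TotalSpace.mk' E x (X x) : TangentBundle I M)) :=
  smooth_iff.1 hX

lemma Smooth.mdiffAt (hX : Smooth X) (p : M) :
    MDifferentiableAt I (I.prod 𝓘(ℝ, E))
      (fun x => (TotalSpace.mk' E x (X x) : TangentBundle I M)) p :=
  hX.contMDiff.mdifferentiableAt (by simp)

lemma smooth_zero : Smooth (0 : VField I M) :=
  smooth_iff.2 (contMDiff_zeroSection ℝ (TangentSpace I : M → Type _))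

lemma Smooth.add (hX : Smooth X) (hY : Smooth Y) : Smooth (X + Y) :=
  smooth_iff.2 (hX.contMDiff.add_section hY.contMDiff)

lemma Smooth.neg (hX : Smooth X) : Smooth (-X) :=
  smooth_iff.2 hX.contMDiff.neg_section

lemma Smooth.smul {h : M → ℝ} (hh : ContMDiff I 𝓘(ℝ) ∞ h) (hX : Smooth X) : Smooth (h • X) :=
  smooth_iff.2 (hh.smul_section hX.contMDiff)

lemma Smooth.sum {ι : Type*} {s : Finset ι} {X : ι → VField I M} (hX : ∀ i, Smooth (X i)) :
    Smooth (∑ i ∈ s, X i) := by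
  classical
  induction s using Finset.induction_on with
  | empty => simpa using smooth_zero
  | insert a s ha h => simpa [Finset.sum_insert ha] using (hX a).add h

lemma Smooth.mlieBracket (hX : Smooth X) (hY : Smooth Y) : Smooth (mlieBracket I X Y) := by
  have : IsManifold I (((⊤ : ℕ∞) : WithTop ℕ∞) + 1) M := ‹IsManifold I ∞ M›
  have : IsManifold I (minSmoothness ℝ 2) M := by
    rw [minSmoothness_of_isRCLikeNormedField]; infer_instance
  exact smooth_iff.2 (ContDiff.mlieBracket_vectorField (m := ⊤) (n := ⊤) hX.contMDiff hY.contMDiff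
    (by simp))

lemma Smooth.clm_apply {f : (x : M) → TangentSpace I x →L[ℝ] TangentSpace I x}
    (hf : ContMDiff I (I.prod 𝓘(ℝ, E →L[ℝ] E)) ∞
      (fun x => TotalSpace.mk' (E →L[ℝ] E)
        (E := fun x : M => TangentSpace I x →L[ℝ] TangentSpace I x) x (f x)))
    (hX : Smooth X) : Smooth (fun x => f x (X x)) :=
  smooth_iff.2 (hf.clm_bundle_apply hX.contMDiff)

lemma Smooth.oneForm_apply {η : (x : M) → TangentSpace I x →L[ℝ] ℝ}
    (hη : ContMDiff I (I.prod 𝓘(ℝ, E →L[ℝ] ℝ)) ∞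
      (fun x => TotalSpace.mk' (E →L[ℝ] ℝ)
        (E := fun x : M => TangentSpace I x →L[ℝ] Trivial M ℝ x) x (η x)))
    (hX : Smooth X) : ContMDiff I 𝓘(ℝ) ∞ (fun x => η x (X x)) := by
  have h : ContMDiff I (I.prod 𝓘(ℝ)) ∞
      (fun x => TotalSpace.mk' ℝ (E := Trivial M ℝ) x (η x (X x))) :=
    hη.clm_bundle_apply hX.contMDiff
  intro x
  have := h x
  rw [contMDiffAt_totalSpace] at this
  exact this.2

/-- A vector field smooth on an open set agrees near each of its points with a smooth vector
field. -/
lemma SmoothOn.exists_smooth_eventuallyEq [T2Space M] {U : Set M} (hX : SmoothOn X U)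
    (hU : IsOpen U) (hp : p ∈ U) : ∃ X' : VField I M, Smooth X' ∧ X' =ᶠ[𝓝 p] X := by
  obtain ⟨ψ, -, hψ⟩ := (SmoothBumpFunction.nhds_basis_tsupport (I := I) p).mem_iff.1
    (hU.mem_nhds hp)
  refine ⟨(ψ : M → ℝ) • X, smooth_iff.2 ?_, ?_⟩
  · exact ContMDiffOn.smul_section_of_tsupport ψ.contMDiff.contMDiffOn hU hψ hX
  · filter_upwards [ψ.eventuallyEq_one] with x hx
    simp [hx]
    rfl

/-- Every tangent vector is the value of a smooth vector field. -/
lemma exists_smooth_apply_eq [T2Space M] (v : TangentSpace I p) :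
    ∃ X : VField I M, Smooth X ∧ X p = v := by
  obtain ⟨U, hU, hXU⟩ := FiberBundle.exists_contMDiffOn_extend (k := ∞) I E v
  obtain ⟨V, hVU, hV, hpV⟩ := mem_nhds_iff.1 hU
  obtain ⟨X', hX', he⟩ :=
    SmoothOn.exists_smooth_eventuallyEq (X := FiberBundle.extend E v) (hXU.mono hVU) hV hpV
  exact ⟨X', hX', by simp [he.self_of_nhds]⟩

end Smoothness

/-! ### Calculus of covariant derivatives and locality of curvature. -/

section Connection

variable {E : Type*} [NormedAddCommGroup E] [NormedSpace ℝ E] [FiniteDimensional ℝ E]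
  {H : Type*} [TopologicalSpace H] {I : ModelWithCorners ℝ E H}
  {M : Type*} [TopologicalSpace M] [ChartedSpace H M] [IsManifold I ∞ M]
  {D : CovariantDerivative I E (TangentSpace I : M → Type _)}
  {X Y Z X' Y' Z' : VField I M} {p : M}

lemma nabla_apply (X Y : VField I M) (p : M) : nabla D X Y p = D Y p (X p) := rfl

lemma cov_add (hX : Smooth X) (hY : Smooth Y) : D (X + Y) p = D X p + D Y p :=
  D.isCovariantDerivativeOn.add (s := Set.univ) (hX.mdiffAt p) (hY.mdiffAt p)

lemma cov_smul {h : M → ℝ} (hh : ContMDiff I 𝓘(ℝ) ∞ h) (hX : Smooth X) :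
    D (h • X) p = h p • D X p + (mvfderiv I h p).smulRight (X p) :=
  D.isCovariantDerivativeOn.leibniz (s := Set.univ) (hX.mdiffAt p)
    (hh.mdifferentiableAt (by simp))

lemma cov_const_smul (a : ℝ) (hX : Smooth X) : D (a • X) p = a • D X p :=
  D.isCovariantDerivativeOn.smul_const (s := Set.univ) a (hX.mdiffAt p)

lemma cov_neg (hX : Smooth X) : D (-X) p = -D X p := by
  simpa using cov_const_smul (D := D) (p := p) (-1) hX

lemma cov_sum {ι : Type*} {s : Finset ι} {X : ι → VField I M} (hX : ∀ i, Smooth (X i)) :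
    D (∑ i ∈ s, X i) p = ∑ i ∈ s, D (X i) p := by
  classical
  induction s using Finset.induction_on with
  | empty => simp
  | insert a s ha h => rw [Finset.sum_insert ha, Finset.sum_insert ha, cov_add (hX a) (.sum hX), h]

lemma cov_congr {X X' : VField I M}
    (hX : MDifferentiableAt I (I.prod 𝓘(ℝ, E))
      (fun x => (TotalSpace.mk' E x (X x) : TangentBundle I M)) p)
    (h : X =ᶠ[𝓝 p] X') : D X p = D X' p := by
  refine D.isCovariantDerivativeOn.congr_of_eventuallyEq (s := Set.univ) hX ?_ Filter.univ_mem h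
  refine hX.congr_of_eventuallyEq ?_
  filter_upwards [h] with x hx
  simp [hx]

lemma Smooth.nabla (hD : CovariantDerivative.ContMDiffCovariantDerivative D ∞)
    (hX : Smooth X) (hY : Smooth Y) : Smooth (nabla D X Y) := by
  have h := hD.contMDiff.contMDiff (σ := Y) (by simpa [Smooth, SmoothOn] using hY)
  rw [contMDiffOn_univ] at h
  exact smooth_iff.2 (h.clm_bundle_apply hX.contMDiff)

lemma curvature_apply (X Y Z : VField I M) (p : M) :
    curvature D X Y Z p = D (nabla D Y Z) p (X p) - D (nabla D X Z) p (Y p)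
      - D Z p (mlieBracket I X Y p) := rfl

/-- The curvature at a point depends only on the germs of the vector fields. -/
lemma curvature_congr (hD : ∀ {X Y : VField I M}, Smooth X → Smooth Y → Smooth (nabla D X Y))
    (hX : Smooth X) (hY : Smooth Y) (hZ : Smooth Z)
    (hXX' : X =ᶠ[𝓝 p] X') (hYY' : Y =ᶠ[𝓝 p] Y') (hZZ' : Z =ᶠ[𝓝 p] Z') :
    curvature D X Y Z p = curvature D X' Y' Z' p := by
  have h1 : ∀ᶠ x in 𝓝 p, D Z x = D Z' x := by
    filter_upwards [hZZ'.eventually_nhds] with x hx using cov_congr (hZ.mdiffAt x) hx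
  have hYZ : nabla D Y Z =ᶠ[𝓝 p] nabla D Y' Z' := by
    filter_upwards [h1, hYY'] with x hx hx'
    simp only [nabla_apply, hx, hx']
    rfl
  have hXZ : nabla D X Z =ᶠ[𝓝 p] nabla D X' Z' := by
    filter_upwards [h1, hXX'] with x hx hx'
    simp only [nabla_apply, hx, hx']
    rfl
  rw [curvature_apply, curvature_apply, cov_congr ((hD hY hZ).mdiffAt p) hYZ,
    cov_congr ((hD hX hZ).mdiffAt p) hXZ, h1.self_of_nhds, hXX'.self_of_nhds,
    hYY'.self_of_nhds, hXX'.mlieBracket_vectorField_eq hYY']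

end Connection

/-! ### Lie brackets as commutators of derivations. -/

section Commutator

variable {E : Type*} [NormedAddCommGroup E] [NormedSpace ℝ E] [FiniteDimensional ℝ E]
  {H : Type*} [TopologicalSpace H] {I : ModelWithCorners ℝ E H}
  {M : Type*} [TopologicalSpace M] [T2Space M] [ChartedSpace H M] [IsManifold I ∞ M]
  {X Y Z X' Y' Z' : VField I M} {p : M}

lemma mlieBracket_jacobi (hX : Smooth X) (hY : Smooth Y) (hZ : Smooth Z) (p : M) :
    mlieBracket I X (mlieBracket I Y Z) p =
      mlieBracket I (mlieBracket I X Y) Z p + mlieBracket I Y (mlieBracket I X Z) p := by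
  have : IsManifold I (minSmoothness ℝ 3) M := by
    rw [minSmoothness_of_isRCLikeNormedField]; infer_instance
  have h2 : minSmoothness ℝ 2 ≤ (∞ : WithTop ℕ∞) := by
    rw [minSmoothness_of_isRCLikeNormedField]; exact WithTop.coe_le_coe.2 (le_top : (2 : ℕ∞) ≤ ⊤)
  exact leibniz_identity_mlieBracket_apply (hX.contMDiff.contMDiffAt.of_le h2)
    (hY.contMDiff.contMDiffAt.of_le h2) (hZ.contMDiff.contMDiffAt.of_le h2)

/-- The Lie bracket acts on smooth functions as the commutator of derivations. -/
lemma mvfderiv_mlieBracket (hX : Smooth X) (hY : Smooth Y) {h : M → ℝ}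
    (hh : ContMDiff I 𝓘(ℝ) ∞ h)
    (hXh : ContMDiff I 𝓘(ℝ) ∞ (fun x => mvfderiv I h x (X x)))
    (hYh : ContMDiff I 𝓘(ℝ) ∞ (fun x => mvfderiv I h x (Y x))) (p : M) :
    mvfderiv I h p (mlieBracket I X Y p) =
      mvfderiv I (fun x => mvfderiv I h x (Y x)) p (X p)
        - mvfderiv I (fun x => mvfderiv I h x (X x)) p (Y p) := by
  -- In a zero tangent space both sides vanish. Otherwise a field Z with Z p ≠ 0 detects scalar
  -- coefficients at p.
  by_cases hv : ∀ v : TangentSpace I p, v = 0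
  · rw [hv (mlieBracket I X Y p), hv (X p), hv (Y p)]; simp
  push Not at hv
  obtain ⟨v, hv⟩ := hv
  obtain ⟨Z, hZ, rfl⟩ := exists_smooth_apply_eq v
  have md : ∀ {k : M → ℝ}, ContMDiff I 𝓘(ℝ) ∞ k → ∀ x, MDifferentiableAt I 𝓘(ℝ) k x :=
    fun hk x => hk.mdifferentiableAt (by simp)
  have key : ∀ {W : VField I M}, Smooth W → mlieBracket I W (h • Z) =
      (fun x => mvfderiv I h x (W x)) • Z + h • mlieBracket I W Z := by
    intro W hW
    ext x
    rw [mlieBracket_smul_right (md hh x) (hZ.mdiffAt x)]; rfl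
  have e : ∀ {W V : VField I M}, Smooth W → Smooth V →
      ContMDiff I 𝓘(ℝ) ∞ (fun x => mvfderiv I h x (V x)) →
      mlieBracket I W (mlieBracket I V (h • Z)) p =
        mvfderiv I (fun x => mvfderiv I h x (V x)) p (W p) • Z p
        + mvfderiv I h p (V p) • mlieBracket I W Z p
        + (mvfderiv I h p (W p) • mlieBracket I V Z p
        + h p • mlieBracket I W (mlieBracket I V Z) p) := by
    intro W V hW hV hVh
    rw [key hV, mlieBracket_add_right ((hZ.smul hVh).mdiffAt p)
      (((hV.mlieBracket hZ).smul hh).mdiffAt p),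
      mlieBracket_smul_right (md hVh p) (hZ.mdiffAt p),
      mlieBracket_smul_right (md hh p) ((hV.mlieBracket hZ).mdiffAt p)]
  -- The Jacobi identity for h • Z, compared with the one for Z, leaves exactly the commutator
  -- defect of h as a coefficient of Z p.
  have J := mlieBracket_jacobi hX hY (hZ.smul hh) p
  rw [e hX hY hYh, e hY hX hXh, key (hX.mlieBracket hY), mlieBracket_jacobi hX hY hZ p] at J
  simp only [Pi.add_apply, Pi.smul_apply'] at J
  have : (mvfderiv I h p (mlieBracket I X Y p) -
      (mvfderiv I (fun x => mvfderiv I h x (Y x)) p (X p)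
        - mvfderiv I (fun x => mvfderiv I h x (X x)) p (Y p))) • Z p = 0 := by
    rw [sub_smul, sub_smul]
    rw [smul_add] at J
    rw [← sub_eq_zero] at J
    rw [← neg_eq_zero, ← J]
    module
  rcases smul_eq_zero.1 this with h0 | h0
  · linarith
  · exact absurd h0 hv

end Commutator

/-- Algebraic curvature tensors: quadrilinear forms with the symmetries of the Riemannian curvature
tensor. -/
structure IsAlgCurvature {V : Type*} [AddCommGroup V] [Module ℝ V] (R : V → V → V → V → ℝ) :
    Prop where
  add_right : ∀ x y z v w, R x y z (v + w) = R x y z v + R x y z w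
  smul_right : ∀ (a : ℝ) x y z w, R x y z (a • w) = a * R x y z w
  skew_left : ∀ x y z w, R x y z w = -R y x z w
  skew_right : ∀ x y z w, R x y z w = -R x y w z
  bianchi : ∀ x y z w, R x y z w + R y z x w + R z x y w = 0

/-! ### Pair symmetry and multilinearity of algebraic curvature tensors. -/

namespace IsAlgCurvature

variable {V : Type*} [AddCommGroup V] [Module ℝ V] {R : V → V → V → V → ℝ}

/-- Milnor's octahedron argument: add four Bianchi identities and cancel by skew-symmetry. Linearity
in the first three slots is then deduced from linearity in the last. -/
lemma pair_symm (hR : IsAlgCurvature R) (x y z w : V) : R x y z w = R z w x y := by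
  linarith [hR.bianchi x y z w, hR.bianchi y z w x, hR.bianchi z w x y, hR.bianchi w x y z,
    hR.skew_right x y z w, hR.skew_right y z x w, hR.skew_right z x y w,
    hR.skew_right z w x y, hR.skew_right w x y z, hR.skew_right w y z x,
    hR.skew_left w y z x, hR.skew_left x z w y, hR.skew_left z x w y, hR.skew_right x z w y,
    hR.skew_left y w x z, hR.skew_right w y x z, hR.skew_left w x y z, hR.skew_left y z w x,
    hR.skew_right y z w x, hR.skew_left z w x y, hR.skew_right w x z y, hR.skew_left w x z y,
    hR.skew_left x w z y, hR.skew_left x y w z, hR.skew_right x y w z]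

lemma add₃ (hR : IsAlgCurvature R) (x y z v w : V) :
    R x y (z + v) w = R x y z w + R x y v w := by
  rw [hR.skew_right, hR.add_right, hR.skew_right x y z, hR.skew_right x y v]; ring

lemma smul₃ (hR : IsAlgCurvature R) (a : ℝ) (x y z w : V) :
    R x y (a • z) w = a * R x y z w := by
  rw [hR.skew_right, hR.smul_right, hR.skew_right x y z]; ring

lemma add₂ (hR : IsAlgCurvature R) (x y v z w : V) :
    R x (y + v) z w = R x y z w + R x v z w := by
  rw [hR.pair_symm, hR.add_right, hR.pair_symm x y, hR.pair_symm x v]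

lemma smul₂ (hR : IsAlgCurvature R) (a : ℝ) (x y z w : V) :
    R x (a • y) z w = a * R x y z w := by
  rw [hR.pair_symm, hR.smul_right, hR.pair_symm x y]

lemma add₁ (hR : IsAlgCurvature R) (x v y z w : V) :
    R (x + v) y z w = R x y z w + R v y z w := by
  rw [hR.pair_symm, hR.add₃, hR.pair_symm x y, hR.pair_symm v y]

lemma smul₁ (hR : IsAlgCurvature R) (a : ℝ) (x y z w : V) :
    R (a • x) y z w = a * R x y z w := by
  rw [hR.pair_symm, hR.smul₃, hR.pair_symm x y]

end IsAlgCurvature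

/-! ### Symmetries and tensoriality of the Riemannian curvature. -/

section LeviCivita

variable {E : Type*} [NormedAddCommGroup E] [NormedSpace ℝ E] [FiniteDimensional ℝ E]
  {H : Type*} [TopologicalSpace H] {I : ModelWithCorners ℝ E H}
  {M : Type*} [TopologicalSpace M] [T2Space M] [ChartedSpace H M] [IsManifold I ∞ M]
  [RiemannianBundle (fun x : M => TangentSpace I x)]
  [IsContMDiffRiemannianBundle I ∞ E (fun x : M => TangentSpace I x)]
  {D : CovariantDerivative I E (TangentSpace I : M → Type _)}
  {X Y Z W X' Y' Z' W' : VField I M} {p : M}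

lemma Smooth.inner_apply (hX : Smooth X) (hY : Smooth Y) :
    ContMDiff I 𝓘(ℝ) ∞ (fun x => (inner ℝ (X x) (Y x) : ℝ)) :=
  ContMDiff.inner_bundle (E := fun x : M => TangentSpace I x) (F := E) (b := fun x => x)
    hX.contMDiff hY.contMDiff

namespace IsLeviCivita

lemma torsion_eq (hD : IsLeviCivita D) (hX : Smooth X) (hY : Smooth Y) (p : M) :
    D Y p (X p) - D X p (Y p) = mlieBracket I X Y p :=
  D.torsion_eq_zero_iff.1 hD.torsion_free (hX.mdiffAt p) (hY.mdiffAt p)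

lemma nabla_smooth (hD : IsLeviCivita D) (hX : Smooth X) (hY : Smooth Y) :
    Smooth (nabla D X Y) :=
  hX.nabla hD.smooth hY

lemma mvfderiv_inner (hD : IsLeviCivita D) (hY : Smooth Y) (hZ : Smooth Z)
    (v : TangentSpace I p) :
    mvfderiv I (fun y => (inner ℝ (Y y) (Z y) : ℝ)) p v
      = inner ℝ (D Y p v) (Z p) + inner ℝ (Y p) (D Z p v) := by
  obtain ⟨X, hX, rfl⟩ := exists_smooth_apply_eq v
  exact hD.metric X Y Z hX hY hZ p

lemma curvature₄_skew_left (X Y Z W : VField I M) (p : M) :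
    curvature₄ D X Y Z W p = -curvature₄ D Y X Z W p := by
  simp only [curvature₄, curvature_apply, mlieBracket_swap_apply (V := Y) (W := X), map_neg,
    ← inner_neg_left]
  congr 1
  abel

/-- Apply XY - YX - [X,Y] = 0 to the function g(Z,W) and expand by metric compatibility; the mixed
first-order terms cancel. -/
lemma curvature₄_skew_right (hD : IsLeviCivita D) (hX : Smooth X) (hY : Smooth Y)
    (hZ : Smooth Z) (hW : Smooth W) :
    curvature₄ D X Y Z W p = -curvature₄ D X Y W Z p := by
  have e : ∀ {V : VField I M} (x : M),
      mvfderiv I (fun y => (inner ℝ (Z y) (W y) : ℝ)) x (V x)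
      = inner ℝ (nabla D V Z x) (W x) + inner ℝ (Z x) (nabla D V W x) :=
    fun x => hD.mvfderiv_inner hZ hW _
  have s1 : ∀ {V : VField I M}, Smooth V →
      ContMDiff I 𝓘(ℝ) ∞ (fun x => (inner ℝ (nabla D V Z x) (W x) : ℝ)) :=
    fun hV => (hD.nabla_smooth hV hZ).inner_apply hW
  have s2 : ∀ {V : VField I M}, Smooth V →
      ContMDiff I 𝓘(ℝ) ∞ (fun x => (inner ℝ (Z x) (nabla D V W x) : ℝ)) :=
    fun hV => hZ.inner_apply (hD.nabla_smooth hV hW)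
  have md : ∀ {k : M → ℝ}, ContMDiff I 𝓘(ℝ) ∞ k → ∀ x, MDifferentiableAt I 𝓘(ℝ) k x :=
    fun hk x => hk.mdifferentiableAt (by simp)
  have hs : ∀ {V : VField I M}, Smooth V → ContMDiff I 𝓘(ℝ) ∞
      (fun x => mvfderiv I (fun y => (inner ℝ (Z y) (W y) : ℝ)) x (V x)) := by
    intro V hV
    simp only [e]
    exact (s1 hV).add (s2 hV)
  have key := mvfderiv_mlieBracket hX hY (hZ.inner_apply hW) (hs hX) (hs hY) p
  have e2 : ∀ {V V' : VField I M}, Smooth V → Smooth V' →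
      mvfderiv I (fun x => mvfderiv I (fun y => (inner ℝ (Z y) (W y) : ℝ)) x (V x)) p (V' p)
      = inner ℝ (D (nabla D V Z) p (V' p)) (W p) + inner ℝ (D Z p (V p)) (D W p (V' p))
        + (inner ℝ (D Z p (V' p)) (D W p (V p)) + inner ℝ (Z p) (D (nabla D V W) p (V' p))) := by
    intro V V' hV hV'
    simp only [e]
    rw [mvfderiv_fun_add (md (s1 hV) p) (md (s2 hV) p), add_apply,
      hD.mvfderiv_inner (hD.nabla_smooth hV hZ) hW, hD.mvfderiv_inner hZ (hD.nabla_smooth hV hW)]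
    rfl
  rw [hD.mvfderiv_inner hZ hW, e2 hX hY, e2 hY hX] at key
  simp only [curvature₄, curvature_apply, inner_sub_left]
  rw [real_inner_comm _ (Z p), real_inner_comm _ (Z p), real_inner_comm _ (Z p)] at *
  linarith

/-- Vanishing torsion turns the cyclic sum into the Jacobi identity. -/
lemma curvature_bianchi (hD : IsLeviCivita D) (hX : Smooth X) (hY : Smooth Y) (hZ : Smooth Z) :
    curvature D X Y Z p + curvature D Y Z X p + curvature D Z X Y p = 0 := by
  have t : ∀ {A B : VField I M}, Smooth A → Smooth B →
      nabla D A B = nabla D B A + mlieBracket I A B := by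
    intro A B hA hB
    ext x
    rw [Pi.add_apply, ← hD.torsion_eq hA hB]
    simp only [nabla_apply]
    abel
  have t2 : ∀ {A B : VField I M}, Smooth A → Smooth B →
      D (nabla D A B) p = D (nabla D B A) p + D (mlieBracket I A B) p := by
    intro A B hA hB
    rw [t hA hB, cov_add (hD.nabla_smooth hB hA) (hA.mlieBracket hB)]
  have j := mlieBracket_jacobi hX hY hZ p
  rw [mlieBracket_swap_apply (V := mlieBracket I X Y),
    mlieBracket_swap (V := X) (W := Z)] at j
  have j2 : mlieBracket I Y (-mlieBracket I Z X) p = -mlieBracket I Y (mlieBracket I Z X) p := by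
    have := mlieBracket_const_smul_right (c := (-1 : ℝ)) (V := Y) ((hZ.mlieBracket hX).mdiffAt p)
    simpa using this
  rw [j2, ← hD.torsion_eq hX (hY.mlieBracket hZ), ← hD.torsion_eq hZ (hX.mlieBracket hY),
    ← hD.torsion_eq hY (hZ.mlieBracket hX)] at j
  simp only [curvature_apply]
  rw [t2 hY hZ, t2 hZ hX, t2 hX hY]
  simp only [add_apply]
  rw [← sub_eq_zero] at j
  rw [← j]
  abel

lemma curvature₄_bianchi (hD : IsLeviCivita D) (hX : Smooth X) (hY : Smooth Y) (hZ : Smooth Z) :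
    curvature₄ D X Y Z W p + curvature₄ D Y Z X W p + curvature₄ D Z X Y W p = 0 := by
  simp only [curvature₄, ← inner_add_left]
  rw [hD.curvature_bianchi hX hY hZ, inner_zero_left]

lemma curvature₄_pair_symm (hD : IsLeviCivita D) (hX : Smooth X) (hY : Smooth Y) (hZ : Smooth Z)
    (hW : Smooth W) : curvature₄ D X Y Z W p = curvature₄ D Z W X Y p := by
  linarith [hD.curvature₄_bianchi (W := W) (p := p) hX hY hZ,
    hD.curvature₄_bianchi (W := X) (p := p) hY hZ hW,
    hD.curvature₄_bianchi (W := Y) (p := p) hZ hW hX,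
    hD.curvature₄_bianchi (W := Z) (p := p) hW hX hY,
    hD.curvature₄_skew_right (p := p) hX hY hZ hW,
    hD.curvature₄_skew_right (p := p) hY hZ hX hW,
    hD.curvature₄_skew_right (p := p) hZ hX hY hW,
    hD.curvature₄_skew_right (p := p) hZ hW hX hY,
    hD.curvature₄_skew_right (p := p) hW hX hY hZ,
    hD.curvature₄_skew_right (p := p) hW hY hZ hX,
    curvature₄_skew_left (D := D) W Y Z X p,
    curvature₄_skew_left (D := D) X Z W Y p,
    curvature₄_skew_left (D := D) Z X W Y p,
    hD.curvature₄_skew_right (p := p) hX hZ hW hY,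
    curvature₄_skew_left (D := D) Y W X Z p,
    hD.curvature₄_skew_right (p := p) hW hY hX hZ,
    curvature₄_skew_left (D := D) W X Y Z p,
    curvature₄_skew_left (D := D) Y Z W X p,
    hD.curvature₄_skew_right (p := p) hY hZ hW hX,
    curvature₄_skew_left (D := D) Z W X Y p,
    hD.curvature₄_skew_right (p := p) hW hX hZ hY,
    curvature₄_skew_left (D := D) W X Z Y p,
    curvature₄_skew_left (D := D) X W Z Y p,
    curvature₄_skew_left (D := D) X Y W Z p,
    hD.curvature₄_skew_right (p := p) hX hY hW hZ]

end IsLeviCivita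

/-- A smooth vector field with a prescribed value at a point. -/
def smoothExt (v : TangentSpace I p) : VField I M := (exists_smooth_apply_eq v).choose

lemma smooth_smoothExt (v : TangentSpace I p) : Smooth (smoothExt v) :=
  (exists_smooth_apply_eq v).choose_spec.1

@[simp] lemma smoothExt_apply (v : TangentSpace I p) : smoothExt v p = v :=
  (exists_smooth_apply_eq v).choose_spec.2

/-- The curvature tensor of a connection on a tangent space, computed with smooth extensions of
tangent vectors. -/
def riem (D : CovariantDerivative I E (TangentSpace I : M → Type _)) (p : M)
    (u v w z : TangentSpace I p) : ℝ :=
  curvature₄ D (smoothExt u) (smoothExt v) (smoothExt w) (smoothExt z) p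

namespace IsLeviCivita

/-- The last slot is pointwise by definition, and the curvature symmetries move each of the other
slots there in turn. Tensoriality thus needs no local frames. -/
lemma curvature₄_congr_apply (hD : IsLeviCivita D) (hX : Smooth X) (hY : Smooth Y)
    (hZ : Smooth Z) (hX' : Smooth X') (hY' : Smooth Y') (hZ' : Smooth Z')
    (hW' : Smooth W') (eX : X p = X' p) (eY : Y p = Y' p) (eZ : Z p = Z' p) (eW : W p = W' p) :
    curvature₄ D X Y Z W p = curvature₄ D X' Y' Z' W' p := by
  have e4 : ∀ {A B C F F' : VField I M}, F p = F' p →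
      curvature₄ D A B C F p = curvature₄ D A B C F' p := by
    intro A B C F F' h
    simp only [curvature₄, h]
  rw [e4 eW, hD.curvature₄_skew_right hX hY hZ hW', e4 eZ,
    ← hD.curvature₄_skew_right hX hY hZ' hW', hD.curvature₄_pair_symm hX hY hZ' hW', e4 eY,
    hD.curvature₄_skew_right hZ' hW' hX hY', e4 eX, ← hD.curvature₄_skew_right hZ' hW' hX' hY',
    hD.curvature₄_pair_symm hZ' hW' hX' hY']

lemma curvature₄_eq_riem (hD : IsLeviCivita D) (hX : Smooth X) (hY : Smooth Y)
    (hZ : Smooth Z) : curvature₄ D X Y Z W p = riem D p (X p) (Y p) (Z p) (W p) :=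
  hD.curvature₄_congr_apply hX hY hZ (smooth_smoothExt _) (smooth_smoothExt _)
    (smooth_smoothExt _) (smooth_smoothExt _) (by simp) (by simp) (by simp) (by simp)

lemma isAlgCurvature_riem (hD : IsLeviCivita D) (p : M) : IsAlgCurvature (riem D p) where
  add_right x y z v w := by
    simp only [riem, curvature₄, smoothExt_apply, inner_add_right]
  smul_right a x y z w := by
    simp only [riem, curvature₄, smoothExt_apply, inner_smul_right]
  skew_left x y z w := curvature₄_skew_left _ _ _ _ _
  skew_right x y z w := hD.curvature₄_skew_right (smooth_smoothExt _) (smooth_smoothExt _)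
    (smooth_smoothExt _) (smooth_smoothExt _)
  bianchi x y z w := hD.curvature₄_bianchi (smooth_smoothExt _) (smooth_smoothExt _)
    (smooth_smoothExt _)

end IsLeviCivita

end LeviCivita

/-! ### Metric f-structures and the covariant derivative of f. -/

namespace MetricFStructure

variable {E : Type*} [NormedAddCommGroup E] [NormedSpace ℝ E] [FiniteDimensional ℝ E]
  {H : Type*} [TopologicalSpace H] {I : ModelWithCorners ℝ E H}
  {M : Type*} [TopologicalSpace M] [T2Space M] [ChartedSpace H M] [IsManifold I ∞ M]
  [RiemannianBundle (fun x : M => TangentSpace I x)]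
  [IsContMDiffRiemannianBundle I ∞ E (fun x : M => TangentSpace I x)]
  {D : CovariantDerivative I E (TangentSpace I : M → Type _)}
  {s : ℕ} {S : MetricFStructure I M s}
  {X Y Z W : VField I M} {p : M}

/-- Compatibility with w = ξ_α, where f ξ_α = 0. -/
lemma η_eq_inner (S : MetricFStructure I M s) (α : Fin s) (v : TangentSpace I p) :
    S.η α p v = inner ℝ v (S.ξ α p) := by
  have h := S.compat p v (S.ξ α p)
  simp only [S.f_ξ, inner_zero_right, S.η_ξ, mul_ite, mul_one, mul_zero, Finset.sum_ite_eq',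
    Finset.mem_univ, if_true] at h
  linarith

lemma inner_ξ_f (S : MetricFStructure I M s) (α : Fin s) (v : TangentSpace I p) :
    inner ℝ (S.ξ α p) (S.f p v) = (0 : ℝ) := by
  rw [real_inner_comm, ← S.η_eq_inner, S.η_f]

lemma inner_f_left (S : MetricFStructure I M s) (v w : TangentSpace I p) :
    (inner ℝ (S.f p v) w : ℝ) = -inner ℝ v (S.f p w) := by
  have h := S.compat p v (S.f p w)
  simp only [S.f_sq, inner_add_right, inner_neg_right, inner_sum, inner_smul_right, S.η_f,
    mul_zero, Finset.sum_const_zero, ← S.η_eq_inner] at h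
  linarith

/-- The image `fX` of a vector field under the structure tensor. -/
def fField (S : MetricFStructure I M s) (X : VField I M) : VField I M := fun x => S.f x (X x)

@[simp] lemma fField_apply (S : MetricFStructure I M s) (X : VField I M) (x : M) :
    S.fField X x = S.f x (X x) := rfl

lemma smooth_fField (S : MetricFStructure I M s) (hX : Smooth X) : Smooth (S.fField X) :=
  hX.clm_apply S.smooth_f

lemma fField_ξ (S : MetricFStructure I M s) (α : Fin s) : S.fField (S.ξ α) = 0 := by
  ext x
  exact S.f_ξ α x

/-- The covariant derivative `(∇_v f) Y` of the structure tensor. -/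
def covF (S : MetricFStructure I M s) (D : CovariantDerivative I E (TangentSpace I : M → Type _))
    (p : M) (v : TangentSpace I p) (Y : VField I M) : TangentSpace I p :=
  D (S.fField Y) p v - S.f p (D Y p v)

lemma cov_fField (S : MetricFStructure I M s) (v : TangentSpace I p) (Y : VField I M) :
    D (S.fField Y) p v = S.covF D p v Y + S.f p (D Y p v) := by
  simp [covF]

lemma eq_zero_of_f_eq_zero (S : MetricFStructure I M s) {v : TangentSpace I p}
    (hf : S.f p v = 0) (hη : ∀ α, S.η α p v = 0) : v = 0 := by
  have h := S.f_sq p v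
  simpa [hf, hη] using h

/-- Differentiate g(fY, Z) = -g(fZ, Y): since f is skew, so is ∇_v f. -/
lemma covF_skew (hD : IsLeviCivita D) (hY : Smooth Y) (hZ : Smooth Z) (v : TangentSpace I p) :
    (inner ℝ (S.covF D p v Y) (Z p) : ℝ) = -inner ℝ (S.covF D p v Z) (Y p) := by
  have h1 := hD.mvfderiv_inner (S.smooth_fField hY) hZ v
  have h2 := hD.mvfderiv_inner (S.smooth_fField hZ) hY v
  have e : (fun y => (inner ℝ (S.fField Y y) (Z y) : ℝ))
      = -(fun y => (inner ℝ (S.fField Z y) (Y y) : ℝ)) := by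
    ext y
    simp only [fField_apply, Pi.neg_apply]
    rw [S.inner_f_left, real_inner_comm]
  rw [e, mvfderiv_neg, neg_apply, h2] at h1
  simp only [cov_fField, fField_apply, inner_add_left] at h1
  have a1 := S.inner_f_left (Z p) (D Y p v)
  have a2 := S.inner_f_left (D Y p v) (Z p)
  have a3 := S.inner_f_left (Y p) (D Z p v)
  have a4 := S.inner_f_left (D Z p v) (Y p)
  rw [real_inner_comm] at a1 a3
  rw [S.inner_f_left (Y p), S.inner_f_left (Z p)] at h1
  linarith

/-! ### Structure equations of S-manifolds: ∇ξ and ∇f. -/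

namespace IsSStructure

/-- This is 2dη^α = 2Φ. It fixes the skew part of ∇ξ_α, so it remains to show that ξ_α is Killing.
-/
lemma inner_cov_ξ_sub (hS : S.IsSStructure) (hD : IsLeviCivita D) (α : Fin s)
    (v w : TangentSpace I p) :
    (inner ℝ (D (S.ξ α) p v) w : ℝ) - inner ℝ (D (S.ξ α) p w) v = 2 * inner ℝ v (S.f p w) := by
  obtain ⟨X, hX, rfl⟩ := exists_smooth_apply_eq v
  obtain ⟨Y, hY, rfl⟩ := exists_smooth_apply_eq w
  have h := hS.extDer_η α X Y hX hY p
  simp only [extDer, Φ, S.η_eq_inner] at h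
  rw [hD.mvfderiv_inner hX (S.smooth_ξ α), hD.mvfderiv_inner hY (S.smooth_ξ α),
    ← hD.torsion_eq hX hY, inner_sub_left] at h
  rw [real_inner_comm, real_inner_comm (X p)]
  linarith

lemma inner_ξ_ξ (S : MetricFStructure I M s) (α β : Fin s) (x : M) :
    (inner ℝ (S.ξ α x) (S.ξ β x) : ℝ) = if β = α then 1 else 0 := by
  rw [← S.η_eq_inner, S.η_ξ]

lemma inner_cov_ξ_skew_ξ (hD : IsLeviCivita D) (α β : Fin s) (v : TangentSpace I p) :
    (inner ℝ (D (S.ξ α) p v) (S.ξ β p) : ℝ) = -inner ℝ (D (S.ξ β) p v) (S.ξ α p) := by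
  have h := hD.mvfderiv_inner (S.smooth_ξ α) (S.smooth_ξ β) v
  simp only [inner_ξ_ξ, mvfderiv_const] at h
  rw [real_inner_comm _ (S.ξ α p)] at h
  simp only [zero_apply] at h
  linarith

/-- Here dη^β(ξ_α, X) = Φ(ξ_α, X) = 0, and both derivative terms differentiate constants. -/
lemma η_mlieBracket_ξ (hS : S.IsSStructure) (α β : Fin s) {X : VField I M} (hX : Smooth X)
    (hη : ∀ x, S.η β x (X x) = S.η β p (X p)) :
    S.η β p (mlieBracket I (S.ξ α) X p) = 0 := by
  have h := hS.extDer_η β (S.ξ α) X (S.smooth_ξ α) hX p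
  simp only [extDer, Φ, hη, S.η_ξ, mvfderiv_const, S.inner_ξ_f, zero_apply] at h
  linarith

/-- Normality with ξ_α in the first slot: f ξ_α = 0 and dη^β(ξ_α, ·) = 0 leave only two terms. -/
lemma f_mlieBracket_ξ (hS : S.IsSStructure) (α : Fin s) {X : VField I M} (hX : Smooth X) :
    S.f p (mlieBracket I (S.ξ α) (S.fField X) p)
      = S.f p (S.f p (mlieBracket I (S.ξ α) X p)) := by
  have h := hS.normal (S.ξ α) X (S.smooth_ξ α) hX p
  have h0 : ∀ β, extDer (S.η β) (S.ξ α) X p = 0 := fun β => by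
    rw [hS.extDer_η β _ _ (S.smooth_ξ α) hX, Φ, S.inner_ξ_f]
  have h1 : (fun y => S.f y (S.ξ α y)) = (0 : VField I M) := S.fField_ξ α
  simp only [nijenhuis, h0, h1, mlieBracket_zero_left, Pi.zero_apply, map_zero, zero_smul,
    Finset.sum_const_zero, smul_zero, add_zero, sub_zero] at h
  exact (sub_eq_zero.1 h).symm

lemma mlieBracket_ξ_ξ (hS : S.IsSStructure) (α β : Fin s) (p : M) :
    mlieBracket I (S.ξ α) (S.ξ β) p = 0 := by
  refine S.eq_zero_of_f_eq_zero ?_ fun γ => hS.η_mlieBracket_ξ α γ (S.smooth_ξ β) (by simp [S.η_ξ])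
  have h := hS.f_mlieBracket_ξ (p := p) α (S.smooth_ξ β)
  rw [S.fField_ξ, mlieBracket_zero_right] at h
  refine S.eq_zero_of_f_eq_zero ?_ fun γ => S.η_f _ _ _
  rw [← h, Pi.zero_apply, map_zero]

lemma mlieBracket_ξ_fField (hS : S.IsSStructure) (α : Fin s) {X : VField I M} (hX : Smooth X)
    (p : M) : mlieBracket I (S.ξ α) (S.fField X) p = S.f p (mlieBracket I (S.ξ α) X p) := by
  rw [← sub_eq_zero]
  refine S.eq_zero_of_f_eq_zero ?_ fun γ => ?_
  · rw [map_sub, hS.f_mlieBracket_ξ α hX, sub_self]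
  · rw [map_sub, S.η_f, sub_zero]
    exact hS.η_mlieBracket_ξ α γ (S.smooth_fField hX) (by simp [S.η_f])

/-- `ℒ_ξ f = 0` in terms of the connection. -/
lemma covF_ξ_eq (hS : S.IsSStructure) (hD : IsLeviCivita D) (α : Fin s) {X : VField I M}
    (hX : Smooth X) (p : M) :
    S.covF D p (S.ξ α p) X = D (S.ξ α) p (S.f p (X p)) - S.f p (D (S.ξ α) p (X p)) := by
  have h := hS.mlieBracket_ξ_fField α hX p
  rw [← hD.torsion_eq (S.smooth_ξ α) hX, ← hD.torsion_eq (S.smooth_ξ α) (S.smooth_fField hX),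
    map_sub, fField_apply] at h
  rw [covF, sub_eq_sub_iff_sub_eq_sub, h]

lemma covF_apply_ξ (α : Fin s) (v : TangentSpace I p) :
    S.covF D p v (S.ξ α) = -S.f p (D (S.ξ α) p v) := by
  rw [covF, S.fField_ξ, CovariantDerivative.zero]
  simp

lemma inner_covF_ξ (hD : IsLeviCivita D) (α : Fin s) (hY : Smooth Y) (v : TangentSpace I p) :
    (inner ℝ (S.covF D p v Y) (S.ξ α p) : ℝ) = -inner ℝ (S.f p (Y p)) (D (S.ξ α) p v) := by
  rw [covF_skew hD hY (S.smooth_ξ α), covF_apply_ξ, inner_neg_left, S.inner_f_left,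
    real_inner_comm, neg_neg]

/-- Since [ξ_α, ξ_β] = 0, the first quantity is symmetric in α and β. The second is skew, because
g(ξ_α, ξ_β) is constant. As dη and Φ vanish on ξ, the two agree, hence both are zero. -/
lemma inner_cov_ξ_ξ (hS : S.IsSStructure) (hD : IsLeviCivita D) (α β : Fin s)
    (w : TangentSpace I p) :
    (inner ℝ (D (S.ξ α) p (S.ξ β p)) w : ℝ) = 0 ∧ inner ℝ (D (S.ξ α) p w) (S.ξ β p) = (0 : ℝ) := by
  have h1 := hS.inner_cov_ξ_sub hD α (S.ξ β p) w
  have h2 := hS.inner_cov_ξ_sub hD β (S.ξ α p) w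
  rw [S.inner_ξ_f] at h1 h2
  have h3 := inner_cov_ξ_skew_ξ (S := S) hD α β w
  have h4 := hD.torsion_eq (S.smooth_ξ α) (S.smooth_ξ β) p
  rw [hS.mlieBracket_ξ_ξ, sub_eq_zero] at h4
  rw [h4] at h2
  constructor <;> linarith

/-- The fundamental 2-form is closed. -/
lemma covF_cyclic (hS : S.IsSStructure) (hD : IsLeviCivita D) (α : Fin s) (hX : Smooth X)
    (hY : Smooth Y) (hZ : Smooth Z) (p : M) :
    (inner ℝ (S.covF D p (X p) Y) (Z p) : ℝ) + inner ℝ (S.covF D p (Y p) Z) (X p)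
      + inner ℝ (S.covF D p (Z p) X) (Y p) = 0 := by
  -- Differentiating `inner_cov_ξ_sub` along A expresses ∇_A f through second covariant derivatives
  -- of ξ_α. In the cyclic sum these combine into curvatures R(·,·)ξ_α, which the first Bianchi
  -- identity cancels.
  have key : ∀ {A B C : VField I M}, Smooth A → Smooth B → Smooth C →
      ((inner ℝ (D (nabla D B (S.ξ α)) p (A p) - D (S.ξ α) p (D B p (A p))) (C p) : ℝ)
        - inner ℝ (D (nabla D C (S.ξ α)) p (A p) - D (S.ξ α) p (D C p (A p))) (B p))
      = 2 * inner ℝ (S.covF D p (A p) C) (B p) := by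
    intro A B C hA hB hC
    have sB := hD.nabla_smooth hB (S.smooth_ξ α)
    have sC := hD.nabla_smooth hC (S.smooth_ξ α)
    have sf := S.smooth_fField hC
    have md : ∀ {U V : VField I M}, Smooth U → Smooth V →
        MDifferentiableAt I 𝓘(ℝ) (fun x => (inner ℝ (U x) (V x) : ℝ)) p :=
      fun hU hV => (hU.inner_apply hV).mdifferentiableAt (by simp)
    have e : (fun x => (inner ℝ (nabla D B (S.ξ α) x) (C x) : ℝ))
        - (fun x => (inner ℝ (nabla D C (S.ξ α) x) (B x) : ℝ))
        = (fun x => (inner ℝ (B x) (S.fField C x) : ℝ))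
          + (fun x => (inner ℝ (B x) (S.fField C x) : ℝ)) := by
      ext x
      simp only [Pi.sub_apply, Pi.add_apply, nabla_apply, hS.inner_cov_ξ_sub hD, fField_apply]
      ring
    have e2 := congrArg (fun k => mvfderiv I k p (A p)) e
    rw [mvfderiv_sub (md sB hC) (md sC hB), mvfderiv_add (md hB sf) (md hB sf), sub_apply,
      add_apply, hD.mvfderiv_inner sB hC, hD.mvfderiv_inner sC hB, hD.mvfderiv_inner hB sf,
      cov_fField] at e2
    simp only [nabla_apply, fField_apply, inner_add_right] at e2
    have a1 := hS.inner_cov_ξ_sub hD α (D B p (A p)) (C p)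
    have a2 := hS.inner_cov_ξ_sub hD α (B p) (D C p (A p))
    rw [inner_sub_left, inner_sub_left]
    rw [real_inner_comm (S.covF D p (A p) C) (B p)] at e2
    linarith
  have hR : ∀ {A B C : VField I M}, Smooth A → Smooth B →
      curvature₄ D A B (S.ξ α) C p =
      (inner ℝ (D (nabla D B (S.ξ α)) p (A p) - D (S.ξ α) p (D B p (A p))) (C p) : ℝ)
        - inner ℝ (D (nabla D A (S.ξ α)) p (B p) - D (S.ξ α) p (D A p (B p))) (C p) := by
    intro A B C hA hB
    rw [curvature₄, curvature_apply, ← hD.torsion_eq hA hB, ← inner_sub_left, map_sub]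
    congr 1
    abel
  have b := hD.curvature₄_bianchi (W := S.ξ α) (p := p) hX hY hZ
  rw [hD.curvature₄_skew_right hX hY hZ (S.smooth_ξ α),
    hD.curvature₄_skew_right hY hZ hX (S.smooth_ξ α),
    hD.curvature₄_skew_right hZ hX hY (S.smooth_ξ α), hR hX hY, hR hY hZ, hR hZ hX] at b
  have k1 := key hX hY hZ
  have k2 := key hY hZ hX
  have k3 := key hZ hX hY
  have s1 := covF_skew (S := S) hD hY hZ (X p)
  have s2 := covF_skew (S := S) hD hZ hX (Y p)
  have s3 := covF_skew (S := S) hD hX hY (Z p)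
  linarith

/-- The Killing equation with one argument in the image of f: closedness of Φ on (ξ_α, X, Y)
combined with ℒ_ξ f = 0. -/
lemma inner_cov_ξ_f (hS : S.IsSStructure) (hD : IsLeviCivita D) (α : Fin s)
    (v w : TangentSpace I p) :
    (inner ℝ (D (S.ξ α) p (S.f p v)) w : ℝ) + inner ℝ (D (S.ξ α) p w) (S.f p v) = 0 := by
  obtain ⟨X, hX, rfl⟩ := exists_smooth_apply_eq v
  obtain ⟨Y, hY, rfl⟩ := exists_smooth_apply_eq w
  have h := hS.covF_cyclic hD α (S.smooth_ξ α) hX hY p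
  rw [hS.covF_ξ_eq hD α hX, inner_covF_ξ hD α hY, covF_apply_ξ, inner_sub_left, inner_neg_left,
    S.inner_f_left (D (S.ξ α) p (X p)), S.inner_f_left (D (S.ξ α) p (Y p)),
    real_inner_comm _ (S.f p (Y p))] at h
  linarith

/-- The horizontal part of v is -f²v, written as f(-f v) so that lemmas about the image of f apply
to it. -/
lemma decomp (S : MetricFStructure I M s) (v : TangentSpace I p) :
    v = S.f p (-S.f p v) + ∑ α, S.η α p v • S.ξ α p := by
  rw [map_neg, S.f_sq]; abel

/-- In an `S`-manifold, `∇_v ξ_α = -f v`. -/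
lemma cov_ξ (hS : S.IsSStructure) (hD : IsLeviCivita D) (α : Fin s) (v : TangentSpace I p) :
    D (S.ξ α) p v = -S.f p v := by
  have skew : ∀ v w : TangentSpace I p,
      (inner ℝ (D (S.ξ α) p v) w : ℝ) + inner ℝ (D (S.ξ α) p w) v = 0 := by
    intro v w
    obtain ⟨u, a, rfl⟩ : ∃ (u : TangentSpace I p) (a : Fin s → ℝ),
      v = S.f p u + ∑ β, a β • S.ξ β p := ⟨_, _, decomp S v⟩
    have h := hS.inner_cov_ξ_f hD α u w
    simp only [map_add, map_sum, map_smul, inner_add_left, inner_add_right, sum_inner, inner_sum,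
      inner_smul_left, inner_smul_right, (hS.inner_cov_ξ_ξ hD α _ w).1,
      (hS.inner_cov_ξ_ξ hD α _ w).2, mul_zero, Finset.sum_const_zero, add_zero]
    linarith
  refine ext_inner_right ℝ fun w => ?_
  have h := hS.inner_cov_ξ_sub hD α v w
  have h' := skew v w
  rw [inner_neg_left, S.inner_f_left]
  linarith

lemma covF_ξ (hS : S.IsSStructure) (hD : IsLeviCivita D) (α : Fin s) (hY : Smooth Y) (p : M) :
    S.covF D p (S.ξ α p) Y = 0 := by
  rw [hS.covF_ξ_eq hD α hY, hS.cov_ξ hD, hS.cov_ξ hD, map_neg, sub_self]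

lemma covF_add (v w : TangentSpace I p) :
    S.covF D p (v + w) Y = S.covF D p v Y + S.covF D p w Y := by
  simp only [covF, map_add]; abel

lemma covF_smul (a : ℝ) (v : TangentSpace I p) : S.covF D p (a • v) Y = a • S.covF D p v Y := by
  simp only [covF, map_smul, smul_sub]

lemma covF_f_f (hS : S.IsSStructure) (hD : IsLeviCivita D) (hY : Smooth Y)
    (v : TangentSpace I p) : S.covF D p v Y = S.covF D p (S.f p (-S.f p v)) Y := by
  have sum : ∀ (t : Finset (Fin s)) (a : Fin s → ℝ),
      S.covF D p (∑ α ∈ t, a α • S.ξ α p) Y = 0 := by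
    intro t a
    induction t using Finset.induction_on with
    | empty => simp [covF]
    | insert i t hi ih => rw [Finset.sum_insert hi, covF_add, covF_smul, hS.covF_ξ hD _ hY, ih]; simp
  conv_lhs => rw [decomp S v, covF_add, sum, add_zero]

/-- Replace each bracket by covariant derivatives; only the derivatives of f survive. -/
lemma nijenhuis_eq (hD : IsLeviCivita D) (hX : Smooth X) (hY : Smooth Y) (p : M) :
    nijenhuis S.f X Y p = S.covF D p (S.f p (X p)) Y - S.covF D p (S.f p (Y p)) X
      + S.f p (S.covF D p (Y p) X) - S.f p (S.covF D p (X p) Y) := by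
  change S.f p (S.f p (mlieBracket I X Y p))
    + mlieBracket I (S.fField X) (S.fField Y) p
    - S.f p (mlieBracket I (S.fField X) Y p)
    - S.f p (mlieBracket I X (S.fField Y) p) = _
  rw [← hD.torsion_eq hX hY, ← hD.torsion_eq (S.smooth_fField hX) (S.smooth_fField hY),
    ← hD.torsion_eq (S.smooth_fField hX) hY, ← hD.torsion_eq hX (S.smooth_fField hY)]
  simp only [cov_fField, fField_apply, map_sub, map_add]
  abel

/-- Pair normality with the horizontal vector Z p, which removes the ξ_α terms, and eliminate the
rest by closedness of Φ on (X, Y, fZ). -/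
lemma inner_covF_f_add (hS : S.IsSStructure) (hD : IsLeviCivita D) (α₀ : Fin s) (hX : Smooth X)
    (hY : Smooth Y) (hZ : Smooth Z) (hZp : ∀ α, S.η α p (Z p) = 0) :
    (inner ℝ (S.covF D p (S.f p (X p)) Y) (Z p) : ℝ)
      + inner ℝ (S.covF D p (S.f p (Y p)) Z) (X p)
      - inner ℝ (S.covF D p (S.f p (Z p)) X) (Y p) = 0 := by
  have h := congrArg (fun v => (inner ℝ v (Z p) : ℝ)) (hS.normal X Y hX hY p)
  have hZ0 : ∀ α, (inner ℝ (S.ξ α p) (Z p) : ℝ) = 0 := fun α => by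
    rw [real_inner_comm, ← S.η_eq_inner, hZp]
  simp only [nijenhuis_eq (S := S) hD hX hY, inner_add_left, inner_sub_left, inner_smul_left,
    sum_inner, hZ0, mul_zero, Finset.sum_const_zero, add_zero, inner_zero_left,
    S.inner_f_left] at h
  have c := hS.covF_cyclic hD α₀ hX hY (S.smooth_fField hZ) p
  have s1 := covF_skew (S := S) (p := p) hD hY (S.smooth_fField hZ) (X p)
  have s2 := covF_skew (S := S) (p := p) hD (S.smooth_fField hZ) hX (Y p)
  have s3 := covF_skew (S := S) (p := p) hD hX hZ (S.f p (Y p))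
  simp only [fField_apply] at c s1 s2
  linarith

/-- With T(X,Y,Z) = g((∇_{fX} f)Y, Z), adding the relation of `inner_covF_f_add` for (X,Y,Z) to that
for (Z,X,Y) gives 2T(X,Y,Z) = 0. -/
lemma inner_covF_eq_zero (hS : S.IsSStructure) (hD : IsLeviCivita D) (α₀ : Fin s)
    (hY : Smooth Y) (hZ : Smooth Z) (hYp : ∀ α, S.η α p (Y p) = 0)
    (hZp : ∀ α, S.η α p (Z p) = 0) (v : TangentSpace I p) :
    (inner ℝ (S.covF D p v Y) (Z p) : ℝ) = 0 := by
  rw [hS.covF_f_f hD hY]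
  obtain ⟨X, hX, h⟩ := exists_smooth_apply_eq (-S.f p v)
  have hXp : ∀ α, S.η α p (X p) = 0 := fun α => by rw [h, map_neg, S.η_f, neg_zero]
  rw [← h]
  have h1 := hS.inner_covF_f_add hD α₀ hX hY hZ hZp
  have h3 := hS.inner_covF_f_add hD α₀ hZ hX hY hYp
  linarith

/-- The covariant derivative of the structure tensor of an `S`-manifold. -/
lemma covF_eq (hS : S.IsSStructure) (hD : IsLeviCivita D) (α₀ : Fin s) (hY : Smooth Y)
    (v : TangentSpace I p) :
    S.covF D p v Y = ∑ α, ((inner ℝ (S.f p v) (S.f p (Y p)) : ℝ) • S.ξ α p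
      + S.η α p (Y p) • S.f p (S.f p v)) := by
  have hξ : ∀ {Y : VField I M} (α : Fin s), Smooth Y →
      (inner ℝ (S.covF D p v Y) (S.ξ α p) : ℝ) = inner ℝ (S.f p v) (S.f p (Y p)) := by
    intro Y α hY
    rw [inner_covF_ξ hD α hY, hS.cov_ξ hD, inner_neg_right, neg_neg, real_inner_comm]
  refine ext_inner_right ℝ fun w => ?_
  obtain ⟨Z, hZ, hZw⟩ := exists_smooth_apply_eq (-S.f p w)
  have hZ' := S.smooth_fField hZ
  have hfw : S.f p (S.f p (-S.f p w)) = S.f p w := by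
    conv_rhs => rw [decomp S w]
    simp [S.f_ξ]
  -- After moving ∇_v f onto fZ by skewness, only the vertical part of Y contributes: horizontal
  -- pairs vanish by `inner_covF_eq_zero`.
  have e1 : (inner ℝ (S.covF D p v Y) (S.fField Z p) : ℝ)
      = -∑ α, S.η α p (Y p) * inner ℝ (S.f p v) (S.f p w) := by
    rw [covF_skew hD hY hZ']
    obtain ⟨W, hW, hWY⟩ := exists_smooth_apply_eq (-S.f p (Y p))
    have h0 := hS.inner_covF_eq_zero (p := p) hD α₀ hZ' (S.smooth_fField hW)
      (fun α => S.η_f _ _ _) (fun α => S.η_f _ _ _) v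
    rw [decomp S (Y p), inner_add_right, ← hWY, ← fField_apply, h0, zero_add, inner_sum]
    congr 1
    refine Finset.sum_congr rfl fun α _ => ?_
    rw [inner_smul_right, hξ α hZ', fField_apply, hZw, hfw]
    congr 1
    rw [map_add, fField_apply, S.η_f, zero_add, map_sum]
    simp [S.η_ξ]
  conv_lhs => rw [decomp S w]
  rw [inner_add_right, ← hZw, ← fField_apply, e1, inner_sum]
  simp only [inner_smul_right, hξ _ hY, sum_inner, inner_add_left, inner_smul_left,
    S.inner_f_left (S.f p v) w, Finset.sum_add_distrib, S.η_eq_inner, mul_neg,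
    Finset.sum_neg_distrib]
  rw [add_comm]
  congr 1
  refine Finset.sum_congr rfl fun α _ => ?_
  rw [real_inner_comm w]
  simp [mul_comm]

end IsSStructure

end MetricFStructure

/-! ### Algebra of curvature tensors determined by sectional curvatures. -/

namespace IsAlgCurvature

section Module

variable {V : Type*} [AddCommGroup V] [Module ℝ V] {R R' : V → V → V → V → ℝ}

lemma sub (hR : IsAlgCurvature R) (hR' : IsAlgCurvature R') :
    IsAlgCurvature (fun x y z w => R x y z w - R' x y z w) where
  add_right x y z v w := by rw [hR.add_right, hR'.add_right]; ring
  smul_right a x y z w := by rw [hR.smul_right, hR'.smul_right]; ring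
  skew_left x y z w := by rw [hR.skew_left, hR'.skew_left]; ring
  skew_right x y z w := by rw [hR.skew_right, hR'.skew_right]; ring
  bianchi x y z w := by linarith [hR.bianchi x y z w, hR'.bianchi x y z w]

lemma self_left (hR : IsAlgCurvature R) (x z w : V) : R x x z w = 0 := by
  linarith [hR.skew_left x x z w]

lemma self_right (hR : IsAlgCurvature R) (x y z : V) : R x y z z = 0 := by
  linarith [hR.skew_right x y z z]

/-- An algebraic curvature tensor whose sectional curvatures vanish on a subspace vanishes on that
subspace. -/
lemma eq_zero_of_sectional (hR : IsAlgCurvature R) (L : Submodule ℝ V)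
    (h : ∀ x ∈ L, ∀ y ∈ L, R x y y x = 0) {x y z w : V} (hx : x ∈ L) (hy : y ∈ L) (hz : z ∈ L)
    (hw : w ∈ L) : R x y z w = 0 := by
  have h1 : ∀ x ∈ L, ∀ y ∈ L, ∀ w ∈ L, R x y y w = 0 := by
    intro x hx y hy w hw
    have h1 := h (x + w) (L.add_mem hx hw) y hy
    rw [hR.add₁, hR.add_right, hR.add_right, h x hx y hy, h w hw y hy] at h1
    have h2 := hR.pair_symm w y y x
    have h3 := hR.skew_left y x w y
    have h4 := hR.skew_right x y w y
    linarith
  have h2 : ∀ x ∈ L, ∀ y ∈ L, ∀ z ∈ L, ∀ w ∈ L, R x y z w = -R x z y w := by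
    intro x hx y hy z hz w hw
    have := h1 x hx (y + z) (L.add_mem hy hz) w hw
    rw [hR.add₂, hR.add₃, hR.add₃, h1 x hx y hy w hw, h1 x hx z hz w hw] at this
    linarith
  have b := hR.bianchi x y z w
  linarith [h2 x hx y hy z hz w hw, h2 y hy z hz x hx w hw, hR.skew_left z x y w,
    hR.skew_left y x z w]

/-- A Kähler-type algebraic curvature tensor with vanishing holomorphic sectional curvature has
vanishing sectional curvature. -/
lemma sectional_eq_zero_of_holomorphic (hR : IsAlgCurvature R) (L : Submodule ℝ V) (J : V →ₗ[ℝ] V)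
    (hJL : ∀ x ∈ L, J x ∈ L) (hJ : ∀ x ∈ L, J (J x) = -x)
    (hRJ : ∀ x ∈ L, ∀ y ∈ L, ∀ z ∈ L, ∀ w ∈ L, R x y (J z) (J w) = R x y z w)
    (h : ∀ x ∈ L, R x (J x) (J x) x = 0) {x y : V} (hx : x ∈ L) (hy : y ∈ L) :
    R x y y x = 0 := by
  have neg_right : ∀ x y z w, R x y z (-w) = -R x y z w := fun x y z w => by
    simpa using hR.smul_right (-1) x y z w
  have neg₂ : ∀ x y z w, R x (-y) z w = -R x y z w := fun x y z w => by
    simpa using hR.smul₂ (-1) x y z w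
  have hRJ' : ∀ x ∈ L, ∀ y ∈ L, ∀ z ∈ L, ∀ w ∈ L, R (J x) (J y) z w = R x y z w := by
    intro x hx y hy z hz w hw
    rw [hR.pair_symm, hRJ z hz w hw x hx y hy, hR.pair_symm]
  -- Polarization: adding the hypothesis at x + y and x - y keeps only the terms of degree two in
  -- each variable.
  have K : ∀ x ∈ L, ∀ y ∈ L, R x (J x) y (J y) + 2 * R x (J y) x (J y) = 0 := by
    intro x hx y hy
    have h1 := h (x + y) (L.add_mem hx hy)
    have h2 := h (x + (-1 : ℝ) • y) (L.add_mem hx (L.smul_mem _ hy))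
    simp only [map_add, map_smul, hR.add₁, hR.add₂, hR.add₃, hR.add_right, hR.smul₁, hR.smul₂,
      hR.smul₃, hR.smul_right] at h1 h2
    have e1 : R y (J x) y (J x) = R x (J y) x (J y) := by
      rw [← hRJ' y hy (J x) (hJL x hx) y hy (J x) (hJL x hx),
        ← hRJ (J y) (hJL y hy) (J (J x)) (hJL _ (hJL x hx)) y hy (J x) (hJL x hx), hJ x hx,
        neg₂, neg_right, neg_neg, hR.skew_left, hR.skew_right, neg_neg]
    have e2 : R x (J y) y (J x) = R x (J y) x (J y) := by
      rw [← hRJ x hx (J y) (hJL y hy) y hy (J x) (hJL x hx), hJ x hx, neg_right,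
        ← hR.skew_right]
    linarith [h x hx, h y hy, hR.skew_right x (J x) (J y) y, hR.skew_right x (J y) (J y) x,
      hR.skew_right x (J y) (J x) y, hR.skew_right y (J x) (J y) x,
      hR.skew_right y (J x) (J x) y, hR.skew_right y (J y) (J x) x,
      hR.pair_symm y (J y) x (J x), hR.pair_symm y (J x) x (J y)]
  -- Bianchi rewrites the mixed term of `K`. Replacing y by Jy in the result gives a second,
  -- independent linear relation between the same two quantities, so both vanish.
  have C : ∀ x ∈ L, ∀ y ∈ L, 3 * R x (J y) x (J y) + R x y x y = 0 := by
    intro x hx y hy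
    have b := hR.bianchi x (J x) y (J y)
    have e1 : R (J x) y x (J y) = -R x (J y) x (J y) := by
      rw [← hRJ' (J x) (hJL x hx) y hy x hx (J y) (hJL y hy), hJ x hx]
      have := hR.smul₁ (-1) x (J y) x (J y)
      simpa using this
    have e2 : R y x (J x) (J y) = -R x y x y := by
      rw [hRJ y hy x hx x hx y hy, hR.skew_left]
    linarith [K x hx y hy]
  have c1 := C x hx y hy
  have c2 := C x hx (J y) (hJL y hy)
  rw [hJ y hy, neg₂, neg_right, neg_neg] at c2
  linarith [hR.skew_right x y y x]

end Module

section Inner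

variable {V : Type*} [NormedAddCommGroup V] [InnerProductSpace ℝ V] {R : V → V → V → V → ℝ}

/-- The model curvature tensor of constant sectional curvature type, deformed by a skew
endomorphism. -/
def model (J : V →ₗ[ℝ] V) (a b : ℝ) (x y z w : V) : ℝ :=
  a * (inner ℝ y z * inner ℝ x w - inner ℝ x z * inner ℝ y w)
    + b * (inner ℝ x (J w) * inner ℝ y (J z) - inner ℝ x (J z) * inner ℝ y (J w)
      - 2 * (inner ℝ x (J y) * inner ℝ z (J w)))

/-- On (x, y, y, x) this tensor has b-part 3b g(x, Jy)², the source of the factor 3 in later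
formulas. -/
lemma isAlgCurvature_model {J : V →ₗ[ℝ] V}
    (hJ : ∀ x y, (inner ℝ x (J y) : ℝ) = -inner ℝ y (J x)) (a b : ℝ) :
    IsAlgCurvature (model J a b) where
  add_right x y z v w := by
    simp only [model, map_add, inner_add_right]; ring
  smul_right t x y z w := by
    simp only [model, map_smul, inner_smul_right]; ring
  skew_left x y z w := by
    simp only [model]; rw [hJ x y]; ring
  skew_right x y z w := by
    simp only [model]; rw [hJ z w]; ring
  bianchi x y z w := by
    simp only [model]
    rw [hJ y x, hJ z x, hJ z y, real_inner_comm x y, real_inner_comm x z, real_inner_comm y z]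
    ring

/-- Sectional curvature on a subspace is constant as soon as it is so on orthonormal pairs. -/
lemma sectional_of_orthonormal (hR : IsAlgCurvature R) (L : Submodule ℝ V) {c : ℝ}
    (h : ∀ x ∈ L, ∀ y ∈ L, (inner ℝ x x : ℝ) = 1 → (inner ℝ y y : ℝ) = 1 →
      (inner ℝ x y : ℝ) = 0 → R x y y x = c) {x y : V} (hx : x ∈ L) (hy : y ∈ L) :
    R x y y x = c * (inner ℝ x x * inner ℝ y y - inner ℝ x y ^ 2) := by
  have h1 : ∀ x ∈ L, ∀ y ∈ L, (inner ℝ x y : ℝ) = 0 →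
      R x y y x = c * (inner ℝ x x * inner ℝ y y) := by
    intro x hx y hy hxy
    by_cases hx0 : x = 0
    · subst hx0
      have := hR.smul_right 0 0 y y 0
      simp only [zero_smul, zero_mul] at this
      simp [this]
    by_cases hy0 : y = 0
    · subst hy0
      have := hR.smul₃ 0 x 0 0 x
      simp only [zero_smul, zero_mul] at this
      simp [this]
    have nx : ‖x‖ ≠ 0 := norm_ne_zero_iff.2 hx0
    have ny : ‖y‖ ≠ 0 := norm_ne_zero_iff.2 hy0
    have := h (‖x‖⁻¹ • x) (L.smul_mem _ hx) (‖y‖⁻¹ • y) (L.smul_mem _ hy)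
      (by rw [inner_smul_left, inner_smul_right, real_inner_self_eq_norm_sq]
          simp only [conj_trivial]; field_simp)
      (by rw [inner_smul_left, inner_smul_right, real_inner_self_eq_norm_sq]
          simp only [conj_trivial]; field_simp)
      (by rw [inner_smul_left, inner_smul_right, hxy, mul_zero, mul_zero])
    rw [hR.smul₁, hR.smul₂, hR.smul₃, hR.smul_right] at this
    rw [real_inner_self_eq_norm_sq, real_inner_self_eq_norm_sq, ← this]
    field_simp
  by_cases hx0 : x = 0
  · subst hx0
    have := hR.smul_right 0 0 y y 0
    simp only [zero_smul, zero_mul] at this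
    simp [this]
  have nx : (inner ℝ x x : ℝ) ≠ 0 := inner_self_ne_zero.2 hx0
  -- Gram–Schmidt: subtracting t x from y makes it orthogonal to x without changing R(x,y,y,x).
  obtain ⟨t, ht⟩ : ∃ t : ℝ, t * inner ℝ x x = inner ℝ x y :=
    ⟨inner ℝ x y / inner ℝ x x, div_mul_cancel₀ _ nx⟩
  have h2 := h1 x hx (y + (-t) • x) (L.add_mem hy (L.smul_mem _ hx)) (by
    rw [inner_add_right, inner_smul_right]; linarith)
  simp only [hR.add₂, hR.add₃, hR.smul₂, hR.smul₃, hR.self_left, hR.self_right,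
    inner_add_left, inner_add_right, inner_smul_left, inner_smul_right, conj_trivial] at h2
  rw [real_inner_comm x y] at h2
  have e : R x y y x = c * (inner ℝ x x * (inner ℝ y y + -t * inner ℝ x y
      + (-t * inner ℝ x y + -t * (-t * inner ℝ x x)))) := by linarith
  rw [e, ← ht]
  ring

end Inner

end IsAlgCurvature

/-! ### Unit normals and Parseval's identity. -/

section Orthonormal

variable {V : Type*} [NormedAddCommGroup V] [InnerProductSpace ℝ V] [FiniteDimensional ℝ V]

/-- Fewer vectors than the dimension have a common unit normal vector. -/
lemma exists_unit_orthogonal {ι : Type*} [Fintype ι] (v : ι → V)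
    (h : Fintype.card ι < Module.finrank ℝ V) :
    ∃ u : V, inner ℝ u u = (1 : ℝ) ∧ ∀ i, (inner ℝ u (v i) : ℝ) = 0 := by
  have h1 : Module.finrank ℝ (Submodule.span ℝ (Set.range v)) < Module.finrank ℝ V :=
    (finrank_range_le_card v).trans_lt h
  have h2 : (Submodule.span ℝ (Set.range v))ᗮ ≠ ⊥ := by
    intro h0
    rw [Submodule.orthogonal_eq_bot_iff] at h0
    rw [h0, finrank_top] at h1
    exact lt_irrefl _ h1
  obtain ⟨u, hu, hu0⟩ := Submodule.exists_mem_ne_zero_of_ne_bot h2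
  have nu : ‖u‖ ≠ 0 := norm_ne_zero_iff.2 hu0
  refine ⟨‖u‖⁻¹ • u, ?_, fun i => ?_⟩
  · rw [inner_smul_left, inner_smul_right, real_inner_self_eq_norm_sq]
    simp only [conj_trivial]; field_simp
  · rw [inner_smul_left, real_inner_comm,
      (Submodule.mem_orthogonal _ _).1 hu _ (Submodule.subset_span ⟨i, rfl⟩), mul_zero]

lemma sum_inner_mul_inner_of_orthonormal {ι : Type*} [Fintype ι] {e : ι → V}
    (he : Orthonormal ℝ e) (hc : Fintype.card ι = Module.finrank ℝ V) (v w : V) :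
    ∑ i, (inner ℝ v (e i) * inner ℝ w (e i) : ℝ) = inner ℝ v w := by
  let b := OrthonormalBasis.mk he
    (he.linearIndependent.span_eq_top_of_card_eq_finrank' hc).ge
  have h := b.sum_inner_mul_inner v w
  simp only [b, OrthonormalBasis.coe_mk] at h
  rw [← h]
  exact Finset.sum_congr rfl fun i _ => by rw [real_inner_comm w]

end Orthonormal

/-! ### Curvature identities of S-manifolds. -/

namespace MetricFStructure

variable {E : Type*} [NormedAddCommGroup E] [NormedSpace ℝ E] [FiniteDimensional ℝ E]
  {H : Type*} [TopologicalSpace H] {I : ModelWithCorners ℝ E H}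
  {M : Type*} [TopologicalSpace M] [T2Space M] [ChartedSpace H M] [IsManifold I ∞ M]
  [RiemannianBundle (fun x : M => TangentSpace I x)]
  [IsContMDiffRiemannianBundle I ∞ E (fun x : M => TangentSpace I x)]
  {D : CovariantDerivative I E (TangentSpace I : M → Type _)}
  {s : ℕ} {S : MetricFStructure I M s}
  {X Y Z W : VField I M} {p : M}

/-- The 1-form `∑_α η^α`. -/
def ηSum (S : MetricFStructure I M s) (p : M) : TangentSpace I p →L[ℝ] ℝ := ∑ α, S.η α p

lemma ηSum_apply (S : MetricFStructure I M s) (v : TangentSpace I p) :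
    S.ηSum p v = ∑ α, S.η α p v := by
  simp [ηSum]

lemma contMDiff_ηSum (S : MetricFStructure I M s) (hX : Smooth X) :
    ContMDiff I 𝓘(ℝ) ∞ (fun x => S.ηSum x (X x)) := by
  simp only [ηSum_apply]
  exact contMDiff_finsetSum fun α _ => hX.oneForm_apply (S.smooth_η α)

lemma mem_L_iff (S : MetricFStructure I M s) {v : TangentSpace I p} :
    v ∈ S.L p ↔ ∀ α, S.η α p v = 0 := by
  simp only [L, vert, S.η_eq_inner]
  constructor
  · intro h α
    rw [real_inner_comm]
    exact (Submodule.mem_orthogonal _ _).1 h _ (Submodule.subset_span ⟨α, rfl⟩)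
  · intro h
    rw [Submodule.mem_orthogonal]
    intro u hu
    induction hu using Submodule.span_induction with
    | mem x hx => obtain ⟨α, rfl⟩ := hx; rw [real_inner_comm]; exact h α
    | zero => simp
    | add x y _ _ hx hy => rw [inner_add_left, hx, hy, add_zero]
    | smul a x _ hx => rw [inner_smul_left, hx, mul_zero]

lemma f_mem_L (S : MetricFStructure I M s) (v : TangentSpace I p) : S.f p v ∈ S.L p :=
  S.mem_L_iff.2 fun α => S.η_f α p v

lemma f_f_of_mem_L (S : MetricFStructure I M s) {v : TangentSpace I p} (hv : v ∈ S.L p) :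
    S.f p (S.f p v) = -v := by
  simp [S.f_sq, S.mem_L_iff.1 hv]

lemma inner_f_f_of_mem_L (S : MetricFStructure I M s) {v : TangentSpace I p} (hv : v ∈ S.L p)
    (w : TangentSpace I p) : (inner ℝ (S.f p v) (S.f p w) : ℝ) = inner ℝ v w := by
  simp [S.compat, S.mem_L_iff.1 hv]

lemma ηSum_of_mem_L (S : MetricFStructure I M s) {v : TangentSpace I p} (hv : v ∈ S.L p) :
    S.ηSum p v = 0 := by
  simp [ηSum_apply, S.mem_L_iff.1 hv]

lemma inner_f_swap (S : MetricFStructure I M s) (v w : TangentSpace I p) :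
    (inner ℝ v (S.f p w) : ℝ) = -inner ℝ w (S.f p v) := by
  rw [← S.inner_f_left w, real_inner_comm]

lemma inner_f_self (S : MetricFStructure I M s) (v : TangentSpace I p) :
    (inner ℝ v (S.f p v) : ℝ) = 0 := by
  linarith [S.inner_f_swap v v]

namespace IsSStructure

/-- π is dual to ∑ ξ_α, whose covariant derivative is -s f. -/
lemma ηSum_cov (hS : S.IsSStructure) (hD : IsLeviCivita D) (hZ : Smooth Z)
    (v : TangentSpace I p) :
    mvfderiv I (fun x => S.ηSum x (Z x)) p v
      = S.ηSum p (D Z p v) - s * inner ℝ (Z p) (S.f p v) := by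
  have e : (fun x => S.ηSum x (Z x)) = fun x => inner ℝ (Z x) ((∑ α, S.ξ α : VField I M) x) := by
    ext x
    simp only [S.ηSum_apply, S.η_eq_inner, Finset.sum_apply, inner_sum]
  rw [e, hD.mvfderiv_inner hZ (.sum S.smooth_ξ), cov_sum S.smooth_ξ]
  simp only [ηSum_apply, S.η_eq_inner, Finset.sum_apply, sum_apply, inner_sum,
    hS.cov_ξ hD, inner_neg_right, Finset.sum_neg_distrib, Finset.sum_const, Finset.card_univ,
    Fintype.card_fin, ← Nat.cast_smul_eq_nsmul ℝ, inner_smul_right]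
  ring

lemma nabla_ξ (hS : S.IsSStructure) (hD : IsLeviCivita D) (α : Fin s) (X : VField I M) :
    nabla D X (S.ξ α) = -S.fField X := by
  ext x
  exact hS.cov_ξ hD α (X x)

lemma curvature_ξ (hS : S.IsSStructure) (hD : IsLeviCivita D) (hX : Smooth X) (hY : Smooth Y)
    (α : Fin s) (p : M) :
    curvature D X Y (S.ξ α) p = S.ηSum p (X p) • S.f p (S.f p (Y p))
      - S.ηSum p (Y p) • S.f p (S.f p (X p)) := by
  rw [curvature_apply, hS.nabla_ξ hD, hS.nabla_ξ hD, cov_neg (S.smooth_fField hX),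
    cov_neg (S.smooth_fField hY), neg_apply, neg_apply, cov_fField, cov_fField, hS.cov_ξ hD,
    ← hD.torsion_eq hX hY, hS.covF_eq hD α hX, hS.covF_eq hD α hY,
    real_inner_comm (S.f p (X p)) (S.f p (Y p)), map_sub, ηSum_apply, ηSum_apply,
    Finset.sum_smul, Finset.sum_smul]
  simp only [Finset.sum_add_distrib]
  abel

lemma riem_ξ (hS : S.IsSStructure) (hD : IsLeviCivita D) (α : Fin s)
    (u v w : TangentSpace I p) :
    riem D p u v (S.ξ α p) w = S.ηSum p v * inner ℝ (S.f p u) (S.f p w)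
      - S.ηSum p u * inner ℝ (S.f p v) (S.f p w) := by
  obtain ⟨X, hX, rfl⟩ := exists_smooth_apply_eq u
  obtain ⟨Y, hY, rfl⟩ := exists_smooth_apply_eq v
  obtain ⟨W, hW, rfl⟩ := exists_smooth_apply_eq w
  rw [← hD.curvature₄_eq_riem hX hY (S.smooth_ξ α), curvature₄, hS.curvature_ξ hD hX hY,
    inner_sub_left, inner_smul_left, inner_smul_left, S.inner_f_left (S.f p (Y p)),
    S.inner_f_left (S.f p (X p))]
  simp only [conj_trivial]
  ring

/-- The behaviour of the curvature of an `S`-manifold under the structure tensor. -/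
lemma riem_f_f (hS : S.IsSStructure) (hD : IsLeviCivita D) (α₀ : Fin s)
    (u v : TangentSpace I p) {w z : TangentSpace I p} (hw : w ∈ S.L p) (hz : z ∈ S.L p) :
    riem D p u v (S.f p w) (S.f p z) = riem D p u v w z
      + s * (inner ℝ u w * inner ℝ v z - inner ℝ v w * inner ℝ u z
        + inner ℝ w (S.f p v) * inner ℝ (S.f p u) z
        - inner ℝ w (S.f p u) * inner ℝ (S.f p v) z) := by
  obtain ⟨X, hX, rfl⟩ := exists_smooth_apply_eq u
  obtain ⟨Y, hY, rfl⟩ := exists_smooth_apply_eq v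
  obtain ⟨W, hW, rfl⟩ := exists_smooth_apply_eq z
  -- Extending w as f Z₀ makes the field horizontal everywhere, so that the π(Z) term of ∇f vanishes
  -- identically and may be dropped before the second differentiation.
  obtain ⟨Z₀, hZ₀, hZw⟩ := exists_smooth_apply_eq (-S.f p w)
  set Z := S.fField Z₀ with hZdef
  have hZ : Smooth Z := S.smooth_fField hZ₀
  have hZp : Z p = w := by
    rw [hZdef, fField_apply, hZw, map_neg, S.f_f_of_mem_L hw, neg_neg]
  have hZL : ∀ x, Z x ∈ S.L x := fun x => S.f_mem_L _
  clear_value Z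
  subst hZp
  let ζ : VField I M := ∑ α, S.ξ α
  have hζ : Smooth ζ := .sum S.smooth_ξ
  have hcov : ∀ (x : M) (v : TangentSpace I x),
      S.covF D x v Z = (inner ℝ (S.f x v) (S.f x (Z x)) : ℝ) • ζ x := by
    intro x v
    rw [hS.covF_eq hD α₀ hZ]
    simp [S.mem_L_iff.1 (hZL x), ζ, Finset.smul_sum]
  have hcovζ : ∀ v : TangentSpace I p, D ζ p v = -((s : ℝ) • S.f p v) := by
    intro v
    simp only [ζ]
    rw [cov_sum S.smooth_ξ, sum_apply]
    simp [hS.cov_ξ hD, ← Nat.cast_smul_eq_nsmul ℝ]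
  have hnab : ∀ {A : VField I M}, nabla D A (S.fField Z) = S.fField (nabla D A Z)
      + (fun x => (inner ℝ (S.fField A x) (S.fField Z x) : ℝ)) • ζ := by
    intro A
    ext x
    rw [nabla_apply, cov_fField, hcov, add_comm]
    rfl
  have hζW : ∀ t : ℝ, (inner ℝ (t • ζ p) (S.f p (W p)) : ℝ) = 0 := by
    intro t
    simp only [ζ, Finset.sum_apply, inner_smul_left, sum_inner, S.inner_ξ_f,
      Finset.sum_const_zero, mul_zero]
  have hηZ : ∀ v : TangentSpace I p, S.ηSum p (D Z p v) = s * inner ℝ (Z p) (S.f p v) := by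
    intro v
    have h := hS.ηSum_cov hD hZ v
    have h0 : (fun x => S.ηSum x (Z x)) = fun _ => 0 := funext fun x => S.ηSum_of_mem_L (hZL x)
    rw [h0, mvfderiv_const, zero_apply] at h
    linarith
  have hA : ∀ {A B : VField I M}, Smooth A → Smooth B →
      (inner ℝ (D (nabla D A (S.fField Z)) p (B p)) (S.f p (W p)) : ℝ)
        = inner ℝ (D (nabla D A Z) p (B p)) (W p)
          + s * inner ℝ (Z p) (S.f p (A p)) * inner ℝ (S.f p (B p)) (W p)
          - s * inner ℝ (A p) (Z p) * inner ℝ (B p) (W p) := by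
    intro A B hA hB
    have hAZ := hD.nabla_smooth hA hZ
    have hh := (S.smooth_fField hA).inner_apply (S.smooth_fField hZ)
    have e1 : (inner ℝ (S.f p (D (nabla D A Z) p (B p))) (S.f p (W p)) : ℝ)
        = inner ℝ (D (nabla D A Z) p (B p)) (W p) := by
      rw [real_inner_comm, S.inner_f_f_of_mem_L hz, real_inner_comm]
    have e2 : (inner ℝ (S.covF D p (B p) (nabla D A Z)) (S.f p (W p)) : ℝ)
        = s * inner ℝ (Z p) (S.f p (A p)) * inner ℝ (S.f p (B p)) (W p) := by
      rw [hS.covF_eq hD α₀ hAZ, Finset.sum_add_distrib, ← Finset.smul_sum, ← Finset.sum_smul,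
        inner_add_left]
      have := hζW (inner ℝ (S.f p (B p)) (S.f p (nabla D A Z p)))
      simp only [ζ, Finset.sum_apply] at this
      rw [this, zero_add, ← ηSum_apply, nabla_apply, hηZ, inner_smul_left, S.inner_f_left,
        S.f_f_of_mem_L hz, inner_neg_right, neg_neg, conj_trivial]
    rw [hnab, cov_add (S.smooth_fField hAZ) (hζ.smul hh), cov_smul hh hζ, add_apply, add_apply,
      inner_add_left, inner_add_left, cov_fField, inner_add_left, e1, e2,
      ContinuousLinearMap.smulRight_apply, hζW, smul_apply, hcovζ, inner_smul_left,
      inner_neg_left, inner_smul_left, fField_apply, fField_apply, real_inner_comm (S.f p (Z p)),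
      S.inner_f_f_of_mem_L (hZL p), real_inner_comm (S.f p (W p)), S.inner_f_f_of_mem_L hz,
      real_inner_comm (A p), real_inner_comm (B p)]
    simp only [conj_trivial]
    ring
  rw [← hD.curvature₄_eq_riem hX hY hZ, ← fField_apply, ← fField_apply,
    ← hD.curvature₄_eq_riem hX hY (S.smooth_fField hZ), curvature₄, curvature₄, curvature_apply,
    curvature_apply, inner_sub_left, inner_sub_left, inner_sub_left, inner_sub_left,
    fField_apply, hA hY hX, hA hX hY]
  have e3 : (inner ℝ (D (S.fField Z) p (mlieBracket I X Y p)) (S.f p (W p)) : ℝ)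
      = inner ℝ (D Z p (mlieBracket I X Y p)) (W p) := by
    rw [cov_fField, hcov, inner_add_left, hζW, zero_add, real_inner_comm,
      S.inner_f_f_of_mem_L hz, real_inner_comm]
  rw [e3]
  ring

end IsSStructure

end MetricFStructure

/-! ### The semi-symmetric connection and its curvature. -/

namespace MetricFStructure

variable {E : Type*} [NormedAddCommGroup E] [NormedSpace ℝ E] [FiniteDimensional ℝ E]
  {H : Type*} [TopologicalSpace H] {I : ModelWithCorners ℝ E H}
  {M : Type*} [TopologicalSpace M] [T2Space M] [ChartedSpace H M] [IsManifold I ∞ M]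
  [RiemannianBundle (fun x : M => TangentSpace I x)]
  [IsContMDiffRiemannianBundle I ∞ E (fun x : M => TangentSpace I x)]
  {D : CovariantDerivative I E (TangentSpace I : M → Type _)}
  {n s : ℕ} {S : MetricFStructure I M s}
  {X Y Z W : VField I M} {p : M} {c : ℝ}

instance : FiniteDimensional ℝ (TangentSpace I p) := inferInstanceAs (FiniteDimensional ℝ E)

lemma semiSymm_apply (S : MetricFStructure I M s)
    (D : CovariantDerivative I E (TangentSpace I : M → Type _)) (Y : VField I M)
    (v : TangentSpace I p) :
    (S.semiSymm D) Y p v = D Y p v + S.ηSum p (Y p) • v := rfl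

lemma nabla_semiSymm (S : MetricFStructure I M s)
    (D : CovariantDerivative I E (TangentSpace I : M → Type _)) (X Y : VField I M) :
    nabla (S.semiSymm D) X Y = nabla D X Y + (fun x => S.ηSum x (Y x)) • X := rfl

lemma smooth_nabla_semiSymm (S : MetricFStructure I M s) (hD : IsLeviCivita D) (hX : Smooth X)
    (hY : Smooth Y) : Smooth (nabla (S.semiSymm D) X Y) := by
  rw [nabla_semiSymm]
  exact (hD.nabla_smooth hX hY).add (hX.smul (S.contMDiff_ηSum hY))

namespace IsSStructure

/-- The curvature of the semi-symmetric non-metric connection. -/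
lemma curvature_semiSymm (hS : S.IsSStructure) (hD : IsLeviCivita D) (hX : Smooth X)
    (hY : Smooth Y) (hZ : Smooth Z) (p : M) :
    curvature (S.semiSymm D) X Y Z p = curvature D X Y Z p
      - (s * inner ℝ (Z p) (S.f p (X p)) : ℝ) • Y p + (s * inner ℝ (Z p) (S.f p (Y p)) : ℝ) • X p
      + S.ηSum p (Z p) • (S.ηSum p (Y p) • X p - S.ηSum p (X p) • Y p) := by
  have h : ∀ {A B : VField I M}, Smooth A → Smooth B →
      (S.semiSymm D) (nabla (S.semiSymm D) A Z) p (B p) =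
      D (nabla D A Z) p (B p) + (S.ηSum p (Z p) • D A p (B p)
        + (S.ηSum p (D Z p (B p)) - s * inner ℝ (Z p) (S.f p (B p))) • A p)
        + (S.ηSum p (D Z p (A p)) + S.ηSum p (Z p) * S.ηSum p (A p)) • B p := by
    intro A B hA hB
    rw [semiSymm_apply, nabla_semiSymm, cov_add (hD.nabla_smooth hA hZ)
      (hA.smul (S.contMDiff_ηSum hZ)), cov_smul (S.contMDiff_ηSum hZ) hA, add_apply, add_apply,
      smul_apply, ContinuousLinearMap.smulRight_apply, hS.ηSum_cov hD hZ, Pi.add_apply,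
      Pi.smul_apply', map_add, map_smul, smul_eq_mul, nabla_apply]
  rw [curvature_apply, curvature_apply, h hY hX, h hX hY, semiSymm_apply, ← hD.torsion_eq hX hY,
    map_sub]
  module

lemma curvature₄_semiSymm (hS : S.IsSStructure) (hD : IsLeviCivita D) (hX : Smooth X)
    (hY : Smooth Y) (p : M) :
    curvature₄ (S.semiSymm D) X Y Y X p = riem D p (X p) (Y p) (Y p) (X p)
      - s * inner ℝ (Y p) (S.f p (X p)) * inner ℝ (X p) (Y p)
      + S.ηSum p (Y p) ^ 2 * inner ℝ (X p) (X p)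
      - S.ηSum p (X p) * S.ηSum p (Y p) * inner ℝ (X p) (Y p) := by
  rw [← hD.curvature₄_eq_riem hX hY hY, curvature₄, curvature₄, hS.curvature_semiSymm hD hX hY hY]
  simp only [inner_add_left, inner_sub_left, inner_smul_left, conj_trivial, S.inner_f_self,
    real_inner_comm (Y p) (X p)]
  ring

lemma sectional_semiSymm (hS : S.IsSStructure) (hD : IsLeviCivita D) (hX : Smooth X)
    (hY : Smooth Y) (hYL : Y p ∈ S.L p)
    (hXY : (inner ℝ (X p) (Y p) : ℝ) = 0) :
    sectional (S.semiSymm D) X Y p = sectional D X Y p := by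
  rw [sectional, sectional, hS.curvature₄_semiSymm hD hX hY, hXY, S.ηSum_of_mem_L hYL,
    hD.curvature₄_eq_riem hX hY hY]
  congr 1
  ring

/-- R(u,v)ξ_α does not depend on α, so the vertical part of z enters only through π(z). -/
lemma riem_vert (hS : S.IsSStructure) (hD : IsLeviCivita D) (u v w z : TangentSpace I p) :
    riem D p u v (∑ α, S.η α p z • S.ξ α p) w
      = S.ηSum p z * (S.ηSum p v * inner ℝ (S.f p u) (S.f p w)
        - S.ηSum p u * inner ℝ (S.f p v) (S.f p w)) := by
  have hR := hD.isAlgCurvature_riem p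
  let φ : TangentSpace I p →ₗ[ℝ] ℝ :=
    { toFun := fun z => riem D p u v z w
      map_add' := fun x y => hR.add₃ _ _ _ _ _
      map_smul' := fun a x => hR.smul₃ _ _ _ _ _ }
  change φ _ = _
  rw [map_sum]
  simp only [map_smul, smul_eq_mul]
  rw [ηSum_apply S z, Finset.sum_mul]
  exact Finset.sum_congr rfl fun α _ => by rw [← hS.riem_ξ hD α]; rfl

lemma f_f_neg_f (S : MetricFStructure I M s) (u : TangentSpace I p) :
    S.f p (S.f p (-S.f p u)) = S.f p u := by
  rw [map_neg, map_neg, S.f_f_of_mem_L (S.f_mem_L u), neg_neg]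

/-- The sectional curvature numerator in terms of horizontal components. -/
lemma riem_eq_horizontal (hS : S.IsSStructure) (hD : IsLeviCivita D) (u v : TangentSpace I p) :
    riem D p u v v u
      = riem D p (S.f p (-S.f p u)) (S.f p (-S.f p v)) (S.f p (-S.f p v)) (S.f p (-S.f p u))
        + S.ηSum p v ^ 2 * inner ℝ (S.f p u) (S.f p u)
        - 2 * (S.ηSum p u * S.ηSum p v * inner ℝ (S.f p u) (S.f p v))
        + S.ηSum p u ^ 2 * inner ℝ (S.f p v) (S.f p v) := by
  have hR := hD.isAlgCurvature_riem p
  have du := decomp S u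
  have dv := decomp S v
  have fu := f_f_neg_f S u
  have fv := f_f_neg_f S v
  have hu := S.ηSum_of_mem_L (S.f_mem_L (-S.f p u))
  have hv := S.ηSum_of_mem_L (S.f_mem_L (-S.f p v))
  have V := hS.riem_vert hD (p := p)
  set u' := S.f p (-S.f p u)
  set v' := S.f p (-S.f p v)
  -- Vertical parts are split off one slot at a time. Pair symmetry moves the first two arguments
  -- into the slots where `riem_vert` applies.
  have e1 : riem D p u v v u = riem D p u v v' u
      + riem D p u v (∑ α, S.η α p v • S.ξ α p) u := by
    rw [← hR.add₃, ← dv]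
  have e2 : riem D p u v v' u = riem D p u v v' u'
      + riem D p u v v' (∑ α, S.η α p u • S.ξ α p) := by
    rw [← hR.add_right, ← du]
  have e3 : riem D p v' u' u v = riem D p v' u' u' v
      + riem D p v' u' (∑ α, S.η α p u • S.ξ α p) v := by
    rw [← hR.add₃, ← du]
  have e4 : riem D p v' u' u' v = riem D p v' u' u' v'
      + riem D p v' u' u' (∑ α, S.η α p v • S.ξ α p) := by
    rw [← hR.add_right, ← dv]
  rw [hR.skew_right u v v' (∑ α, _), V, fv] at e2
  rw [V, hu, hv] at e3
  rw [hR.skew_right v' u' u' (∑ α, _), V, hu, hv] at e4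
  rw [V] at e1
  have e5 := hR.pair_symm u v v' u'
  have e6 := hR.pair_symm u' v' v' u'
  have e7 := hR.skew_right u v v' u
  rw [real_inner_comm (S.f p u) (S.f p v)] at *
  linarith

end IsSStructure

/-! ### Traces over an orthonormal frame. -/

section Trace

variable {ι : Type*} [Fintype ι] {e : ι → TangentSpace I p}

lemma sum_inner_f_self (S : MetricFStructure I M s) (he : Orthonormal ℝ e)
    (hι : Fintype.card ι = Module.finrank ℝ E) (hE : Module.finrank ℝ E = 2 * n + s) :
    ∑ i, (inner ℝ (S.f p (e i)) (S.f p (e i)) : ℝ) = 2 * n := by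
  have h1 : ∀ i, (inner ℝ (e i) (e i) : ℝ) = 1 := fun i => by
    rw [real_inner_self_eq_norm_sq, he.1 i, one_pow]
  simp only [S.compat, h1, Finset.sum_sub_distrib]
  rw [Finset.sum_comm]
  have h2 : ∀ α, ∑ i, S.η α p (e i) * S.η α p (e i) = 1 := fun α => by
    have := sum_inner_mul_inner_of_orthonormal he hι (S.ξ α p) (S.ξ α p)
    rw [IsSStructure.inner_ξ_ξ, if_pos rfl] at this
    rw [← this]
    exact Finset.sum_congr rfl fun i _ => by rw [S.η_eq_inner, real_inner_comm]
  simp only [h2, Finset.sum_const, Finset.card_univ, Fintype.card_fin, hι, hE, nsmul_eq_mul]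
  push_cast
  ring

lemma sum_inner_f_f_sq (S : MetricFStructure I M s) (he : Orthonormal ℝ e)
    (hι : Fintype.card ι = Module.finrank ℝ E) (u : TangentSpace I p) :
    ∑ j, (inner ℝ (S.f p u) (S.f p (e j)) : ℝ) ^ 2 = inner ℝ (S.f p u) (S.f p u) := by
  have := sum_inner_mul_inner_of_orthonormal he hι (S.f p (S.f p u)) (S.f p (S.f p u))
  rw [S.inner_f_f_of_mem_L (S.f_mem_L u)] at this
  rw [← this]
  exact Finset.sum_congr rfl fun j _ => by rw [S.inner_f_left (S.f p u)]; ring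

lemma sum_inner_f_sq (S : MetricFStructure I M s) (he : Orthonormal ℝ e)
    (hι : Fintype.card ι = Module.finrank ℝ E) (u : TangentSpace I p) :
    ∑ j, (inner ℝ u (S.f p (e j)) : ℝ) ^ 2 = inner ℝ (S.f p u) (S.f p u) := by
  rw [← sum_inner_mul_inner_of_orthonormal he hι (S.f p u) (S.f p u)]
  exact Finset.sum_congr rfl fun j _ => by rw [S.inner_f_left u]; ring

lemma ηSum_eq_inner (S : MetricFStructure I M s) (u : TangentSpace I p) :
    S.ηSum p u = inner ℝ (∑ α, S.ξ α p) u := by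
  rw [ηSum_apply, sum_inner]
  exact Finset.sum_congr rfl fun α _ => by rw [S.η_eq_inner, real_inner_comm]

lemma sum_ηSum_sq (S : MetricFStructure I M s) (he : Orthonormal ℝ e)
    (hι : Fintype.card ι = Module.finrank ℝ E) : ∑ j, S.ηSum p (e j) ^ 2 = s := by
  have h := sum_inner_mul_inner_of_orthonormal he hι (∑ α, S.ξ α p) (∑ α, S.ξ α p)
  have h2 : (inner ℝ (∑ α, S.ξ α p) (∑ α, S.ξ α p) : ℝ) = s := by
    simp only [sum_inner, inner_sum, IsSStructure.inner_ξ_ξ, Finset.sum_ite_eq, Finset.mem_univ,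
      if_true, Finset.sum_const, Finset.card_univ, Fintype.card_fin, nsmul_eq_mul, mul_one]
  rw [← h2, ← h]
  exact Finset.sum_congr rfl fun j _ => by rw [ηSum_eq_inner]; ring

lemma sum_ηSum_mul_inner (S : MetricFStructure I M s) (he : Orthonormal ℝ e)
    (hι : Fintype.card ι = Module.finrank ℝ E) (u : TangentSpace I p) :
    ∑ j, S.ηSum p (e j) * inner ℝ (S.f p u) (S.f p (e j)) = 0 := by
  have h := sum_inner_mul_inner_of_orthonormal he hι (∑ α, S.ξ α p) (S.f p (-S.f p u))
  rw [← ηSum_eq_inner, S.ηSum_of_mem_L (S.f_mem_L _)] at h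
  rw [← h]
  exact Finset.sum_congr rfl fun j _ => by
    rw [ηSum_eq_inner, S.inner_f_left (-S.f p u), inner_neg_left, neg_neg]

end Trace

/-! ### Scalar curvature and the constant-curvature cases. -/

namespace IsSStructure

/-- The scalar curvature of the semi-symmetric connection when the sectional curvatures of the
horizontal planes are those of a model tensor. -/
lemma hasScalarCurvature_semiSymm (hS : S.IsSStructure) (hD : IsLeviCivita D)
    (hE : Module.finrank ℝ E = 2 * n + s) {a b : ℝ}
    (hR : ∀ (p : M), ∀ u ∈ S.L p, ∀ v ∈ S.L p, riem D p u v v u =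
      a * (inner ℝ u u * inner ℝ v v - inner ℝ u v ^ 2) + 3 * b * inner ℝ u (S.f p v) ^ 2) :
    HasScalarCurvature (S.semiSymm D)
      (fun _ => (1 / 2) * (a * (4 * n ^ 2 - 2 * n) + 6 * b * n + 4 * n * s
        + (2 * n + s - 1) * s)) := by
  classical
  intro U e hU he ho p hp
  have hι : Fintype.card (Fin (Module.finrank ℝ E)) = Module.finrank ℝ E := Fintype.card_fin _
  have ho := ho p hp
  have hδ : ∀ i j, (inner ℝ (e i p) (e j p) : ℝ) = if i = j then 1 else 0 :=
    orthonormal_iff_ite.1 ho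
  -- The final correction makes the expression vanish for i = j, matching the convention 0/0 = 0 in
  -- `sectional`; for i ≠ j the denominator is 1.
  have hsec : ∀ i j, sectional (S.semiSymm D) (e i) (e j) p =
      a * (inner ℝ (S.f p (e i p)) (S.f p (e i p)) * inner ℝ (S.f p (e j p)) (S.f p (e j p))
        - inner ℝ (S.f p (e i p)) (S.f p (e j p)) ^ 2)
      + 3 * b * inner ℝ (e i p) (S.f p (e j p)) ^ 2
      + S.ηSum p (e j p) ^ 2 * inner ℝ (S.f p (e i p)) (S.f p (e i p))
      - 2 * S.ηSum p (e i p) *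
        (S.ηSum p (e j p) * inner ℝ (S.f p (e i p)) (S.f p (e j p)))
      + S.ηSum p (e i p) ^ 2 * inner ℝ (S.f p (e j p)) (S.f p (e j p))
      + S.ηSum p (e j p) ^ 2 - if i = j then S.ηSum p (e i p) ^ 2 else 0 := by
    -- The frame is smooth only on U, so globally smooth fields with the same germs replace it.
    intro i j
    obtain ⟨X, hX, hXe⟩ := (he i).exists_smooth_eventuallyEq hU hp
    obtain ⟨Y, hY, hYe⟩ := (he j).exists_smooth_eventuallyEq hU hp
    have h1 : curvature₄ (S.semiSymm D) (e i) (e j) (e j) (e i) p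
        = curvature₄ (S.semiSymm D) X Y Y X p := by
      rw [curvature₄, curvature₄, curvature_congr (fun h h' => S.smooth_nabla_semiSymm hD h h')
        hX hY hY hXe hYe hYe, hXe.self_of_nhds]
    have hf : ∀ u v : TangentSpace I p, (inner ℝ (S.f p (-S.f p u)) (S.f p (-S.f p v)) : ℝ)
        = inner ℝ (S.f p u) (S.f p v) := fun u v => by
      rw [map_neg, map_neg, inner_neg_neg, S.inner_f_f_of_mem_L (S.f_mem_L u)]
    have hf' : ∀ u v : TangentSpace I p, (inner ℝ (S.f p (-S.f p u)) (S.f p (S.f p (-S.f p v))) : ℝ)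
        = inner ℝ u (S.f p v) := fun u v => by
      rw [f_f_neg_f, S.inner_f_f_of_mem_L ((S.L p).neg_mem (S.f_mem_L u)), inner_neg_left,
        S.inner_f_left, neg_neg]
    rw [sectional, h1, hS.curvature₄_semiSymm hD hX hY, hXe.self_of_nhds, hYe.self_of_nhds,
      hS.riem_eq_horizontal hD, hR p _ (S.f_mem_L _) _ (S.f_mem_L _), hf, hf, hf, hf',
      hδ, hδ, hδ, if_pos rfl, if_pos rfl]
    by_cases hij : i = j
    · subst hij
      simp only [if_true, S.inner_f_self]
      ring
    · simp only [if_neg hij]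
      ring
  have hrow : ∀ i, ∑ j, sectional (S.semiSymm D) (e i) (e j) p =
      (a * (2 * n - 1) + 3 * b + s) * inner ℝ (S.f p (e i p)) (S.f p (e i p))
        + (2 * n - 1) * S.ηSum p (e i p) ^ 2 + s := by
    intro i
    simp only [hsec, Finset.sum_add_distrib, Finset.sum_sub_distrib, ← Finset.mul_sum,
      ← Finset.sum_mul, S.sum_inner_f_self ho hι hE, S.sum_inner_f_f_sq ho hι,
      S.sum_inner_f_sq ho hι, S.sum_ηSum_sq ho hι, S.sum_ηSum_mul_inner ho hι,
      Finset.sum_ite_eq, Finset.mem_univ, if_true]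
    ring
  simp only [hrow, Finset.sum_add_distrib, ← Finset.mul_sum, S.sum_inner_f_self ho hι hE,
    S.sum_ηSum_sq ho hι, Finset.sum_const, Finset.card_univ, Fintype.card_fin, hE, nsmul_eq_mul]
  push_cast
  ring

lemma riem_of_hasConstLSectional (hS : S.IsSStructure) (hD : IsLeviCivita D)
    (h : S.HasConstLSectional (S.semiSymm D) c) {u v : TangentSpace I p} (hu : u ∈ S.L p)
    (hv : v ∈ S.L p) :
    riem D p u v v u = c * (inner ℝ u u * inner ℝ v v - inner ℝ u v ^ 2) := by
  refine (hD.isAlgCurvature_riem p).sectional_of_orthonormal (S.L p) ?_ hu hv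
  intro x hx y hy hxx hyy hxy
  have := h (smoothExt x) (smoothExt y) (smooth_smoothExt x) (smooth_smoothExt y) p
    (by simpa using hx) (by simpa using hy) (by simpa using hxx) (by simpa using hyy)
    (by simpa using hxy)
  rw [hS.sectional_semiSymm hD (smooth_smoothExt x) (smooth_smoothExt y)
    (by simpa using hy) (by simpa using hxy), sectional, hD.curvature₄_eq_riem
    (smooth_smoothExt x) (smooth_smoothExt y) (smooth_smoothExt y)] at this
  simp only [smoothExt_apply, hxx, hyy, hxy] at this
  rw [← this]
  ring

/-- The coefficients a = (c + 3s)/4 and b = (c - s)/4 solve a + 3b = c, which matches the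
f-sectional curvature, and a - b = s, which matches the defect in `riem_f_f`. Hence R minus the
model is of Kähler type on ℒ. -/
lemma riem_of_hasConstFSectional (hS : S.IsSStructure) (hD : IsLeviCivita D) (α₀ : Fin s)
    (h : S.HasConstFSectional D c) {u v : TangentSpace I p} (hu : u ∈ S.L p)
    (hv : v ∈ S.L p) :
    riem D p u v v u = (c + 3 * s) / 4 * (inner ℝ u u * inner ℝ v v - inner ℝ u v ^ 2)
      + 3 * ((c - s) / 4) * inner ℝ u (S.f p v) ^ 2 := by
  have hR := hD.isAlgCurvature_riem p
  have hM := IsAlgCurvature.isAlgCurvature_model (J := (S.f p : TangentSpace I p →ₗ[ℝ] _))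
    (fun x y => S.inner_f_swap x y) ((c + 3 * s) / 4) ((c - s) / 4)
  have h1 : ∀ x ∈ S.L p, riem D p x (S.f p x) (S.f p x) x = c * inner ℝ x x ^ 2 := by
    intro x hx
    by_cases hx0 : x = 0
    · subst hx0
      rw [map_zero, hR.self_left]
      simp
    have nx : ‖x‖ ≠ 0 := norm_ne_zero_iff.2 hx0
    have hy : ‖x‖⁻¹ • x ∈ S.L p := (S.L p).smul_mem _ hx
    have hyy : (inner ℝ (‖x‖⁻¹ • x) (‖x‖⁻¹ • x) : ℝ) = 1 := by
      rw [inner_smul_left, inner_smul_right, real_inner_self_eq_norm_sq]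
      simp only [conj_trivial]; field_simp
    have := h (smoothExt (‖x‖⁻¹ • x)) (smooth_smoothExt _) p (by simpa using hy)
      (by simpa using hyy)
    rw [sectional, show (fun y => S.f y (smoothExt (‖x‖⁻¹ • x) y))
      = S.fField (smoothExt (‖x‖⁻¹ • x)) from rfl, hD.curvature₄_eq_riem (smooth_smoothExt _)
      (S.smooth_fField (smooth_smoothExt _)) (S.smooth_fField (smooth_smoothExt _)),
      smoothExt_apply, fField_apply, smoothExt_apply, S.inner_f_f_of_mem_L hy, S.inner_f_self, hyy,
      map_smul, hR.smul₁, hR.smul₂, hR.smul₃, hR.smul_right] at this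
    rw [real_inner_self_eq_norm_sq, ← this]
    field_simp
    ring
  have key := (hR.sub hM).sectional_eq_zero_of_holomorphic (S.L p)
    (S.f p : TangentSpace I p →ₗ[ℝ] _) (fun x _ => S.f_mem_L x) (fun x hx => S.f_f_of_mem_L hx)
    (fun x hx y hy z hz w hw => by
      simp only [IsAlgCurvature.model, ContinuousLinearMap.coe_coe]
      rw [hS.riem_f_f hD α₀ x y hz hw, S.inner_f_f_of_mem_L hz, S.f_f_of_mem_L hw,
        S.f_f_of_mem_L hz, S.inner_f_left x w, S.inner_f_left y w, S.inner_f_swap z y,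
        S.inner_f_swap z x]
      simp only [inner_neg_right]
      ring)
    (fun x hx => by
      simp only [IsAlgCurvature.model, ContinuousLinearMap.coe_coe]
      rw [h1 x hx, S.inner_f_f_of_mem_L hx, S.f_f_of_mem_L hx, S.inner_f_self]
      simp only [inner_neg_right]
      ring) hu hv
  simp only [IsAlgCurvature.model, ContinuousLinearMap.coe_coe, S.inner_f_self] at key
  rw [S.inner_f_swap v u, real_inner_comm u v] at key
  linarith

lemma eq_of_hasConstLSectional (hS : S.IsSStructure) (hD : IsLeviCivita D) (α₀ : Fin s)
    (hE : Module.finrank ℝ E = 2 * n + s) (hn : 2 ≤ n) (p : M)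
    (h : S.HasConstLSectional (S.semiSymm D) c) : c = s := by
  have hR := hD.isAlgCurvature_riem p
  have hM := IsAlgCurvature.isAlgCurvature_model (J := (S.f p : TangentSpace I p →ₗ[ℝ] _))
    (fun x y => S.inner_f_swap x y) c 0
  have hdim : Module.finrank ℝ (TangentSpace I p) = 2 * n + s := hE
  obtain ⟨u, huu, hu⟩ := exists_unit_orthogonal (fun α => S.ξ α p)
    (by rw [Fintype.card_fin, hdim]; omega)
  -- A vector orthogonal to the s fields ξ_α and to u, fu requires s + 2 < 2n + s; here n ≥ 2
  -- enters.
  obtain ⟨v, hvv, hv⟩ := exists_unit_orthogonal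
    (Sum.elim (fun α => S.ξ α p) ![u, S.f p u])
    (by rw [Fintype.card_sum, Fintype.card_fin, Fintype.card_fin, hdim]; omega)
  have huL : u ∈ S.L p := S.mem_L_iff.2 fun α => by rw [S.η_eq_inner]; exact hu α
  have hvL : v ∈ S.L p := S.mem_L_iff.2 fun α => by rw [S.η_eq_inner]; exact hv (Sum.inl α)
  have hvu : (inner ℝ v u : ℝ) = 0 := hv (Sum.inr 0)
  have hvfu : (inner ℝ v (S.f p u) : ℝ) = 0 := hv (Sum.inr 1)
  -- The constant-curvature tensor vanishes on (u, v, fv, fu), whereas `riem_f_f` evaluates R there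
  -- to c - s.
  have key := (hR.sub hM).eq_zero_of_sectional (S.L p) (fun x hx y hy => by
    simp only [IsAlgCurvature.model]
    rw [hS.riem_of_hasConstLSectional hD h hx hy, real_inner_comm x y]
    ring) huL hvL (S.f_mem_L v) (S.f_mem_L u)
  simp only [IsAlgCurvature.model, S.inner_f_self] at key
  rw [hS.riem_f_f hD α₀ u v hvL huL, hS.riem_of_hasConstLSectional hD h huL hvL,
    S.inner_f_self, S.inner_f_left u u, S.inner_f_self, real_inner_comm v u, hvu, huu, hvv,
    hvfu] at key
  linarith

end IsSStructure

end MetricFStructure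

end SGeom

end

/-! ### The main theorem. -/

theorem mainTheorem4 {n s : ℕ} (hs : 1 ≤ s) {M : Type*} [TopologicalSpace M] [T2Space M]
    [ChartedSpace (EuclideanSpace ℝ (Fin (2 * n + s))) M] [IsManifold (𝓡 (2 * n + s)) ∞ M]
    [RiemannianBundle (fun x : M => TangentSpace (𝓡 (2 * n + s)) x)]
    [IsContMDiffRiemannianBundle (𝓡 (2 * n + s)) ∞ (EuclideanSpace ℝ (Fin (2 * n + s)))
      (fun x : M => TangentSpace (𝓡 (2 * n + s)) x)]
    (S : SGeom.MetricFStructure (𝓡 (2 * n + s)) M s) (hS : S.IsSStructure)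
    (D : CovariantDerivative (𝓡 (2 * n + s)) (EuclideanSpace ℝ (Fin (2 * n + s)))
      (TangentSpace (𝓡 (2 * n + s)) : M → Type _)) (hD : SGeom.IsLeviCivita D) :
    (∀ X Y : SGeom.VField (𝓡 (2 * n + s)) M, SGeom.Smooth X → SGeom.Smooth Y →
      ∀ p, X p ∈ S.L p → Y p ∈ S.L p → inner ℝ (X p) (Y p) = (0 : ℝ) →
        SGeom.sectional (S.semiSymm D) X Y p = SGeom.sectional D X Y p) ∧
    (2 ≤ n → Nonempty M → ∀ c : ℝ, S.HasConstLSectional (S.semiSymm D) c → c = s) ∧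
    (S.HasConstLSectional (S.semiSymm D) s →
      SGeom.HasScalarCurvature (S.semiSymm D)
        (fun _ => 2 * n * s * (n + 1) + (s : ℝ) * (s - 1) / 2)) ∧
    (∀ c : ℝ, S.HasConstFSectional (S.semiSymm D) c ↔ S.HasConstFSectional D c) ∧
    (∀ c : ℝ, S.HasConstFSectional D c →
      SGeom.HasScalarCurvature (S.semiSymm D)
        (fun _ => ((n : ℝ) * (n + 1) * (c + 3 * s) + s * (s - 1)) / 2)) := by
  have hE : Module.finrank ℝ (EuclideanSpace ℝ (Fin (2 * n + s))) = 2 * n + s :=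
    finrank_euclideanSpace_fin
  have hF : ∀ c : ℝ, S.HasConstFSectional (S.semiSymm D) c ↔ S.HasConstFSectional D c := by
    intro c
    have e : ∀ X : SGeom.VField (𝓡 (2 * n + s)) M, SGeom.Smooth X → ∀ p,
        SGeom.sectional (S.semiSymm D) X (fun x => S.f x (X x)) p
          = SGeom.sectional D X (fun x => S.f x (X x)) p := fun X hX p =>
      hS.sectional_semiSymm hD hX (S.smooth_fField hX) (S.f_mem_L _) (S.inner_f_self _)
    constructor
    · intro h X hX p hL h1
      rw [← e X hX, h X hX p hL h1]
    · intro h X hX p hL h1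
      rw [e X hX, h X hX p hL h1]
  refine ⟨fun X Y hX hY p _ hYL hXY => hS.sectional_semiSymm hD hX hY hYL hXY,
    fun hn ⟨p⟩ c h => hS.eq_of_hasConstLSectional hD ⟨0, hs⟩ hE hn p h, fun h => ?_, hF,
    fun c h => ?_⟩
  · convert hS.hasScalarCurvature_semiSymm (a := s) (b := 0) hD hE fun p u hu v hv => ?_ using 2
    · ring
    · rw [hS.riem_of_hasConstLSectional hD h hu hv]
      ring
  · convert hS.hasScalarCurvature_semiSymm hD hE fun p u hu v hv =>
      hS.riem_of_hasConstFSectional hD ⟨0, hs⟩ h hu hv using 2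
    ring
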